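/- Let $f_1,f_2:\mathbb{R}^2\to\mathbb{R}^2$ be the affine maps with eigenvalues $\lambda_1=\lambda_2=\tfrac23$ and $\nu_1=\nu_2=\tfrac13$ given by \[ f_1(x_1,x_2)=\left(\tfrac23x_1+\tfrac13,\ \tfrac13x_2\right),\qquad f_2(x_1,x_2)=\left(\tfrac13x_1,\ \tfrac23x_2+\tfrac13\right), \] with fixed points $e_1=(1,0)$ and $e_2=(0,1)$. (In the family \[ f_1(x)=(\lambda_1x_1+\alpha x_2+1-\lambda_1,\ \nu_1x_2),\qquad f_2(x)=(\nu_2x_1,\ \beta x_1+\lambda_2x_2+1-\lambda_2), \] with $\alpha=\nu_2+\lambda_1-1$ and $\beta=\nu_1+\lambda_2-1$, this is the case $\alpha=\beta=0$.) For a finite word $\mathbf{j}=j_1\dots j_k$ over $\{1,2\}$ put $f_{\mathbf{j}}=f_{j_1}\circ\dots\circ f_{j_k}$ (the identity for the empty word), and let $z=f_1(e_2)=f_2(e_1)$. A line $V$ is *tangent* to a set $B\subset\mathbb{R}^2$ at $x\in V\cap B$ if for every $\delta>0$ there is $\varepsilon>0$ such that $\operatorname{dist}(b,V)/|x-b|<\delta$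 for all $b\in B\setminus\{x\}$ with $|x-b|<\varepsilon$. There is a unique nonempty compact set $J\subset\mathbb{R}^2$ with $J=f_1(J)\cup f_2(J)$, and it has the following properties. 1. The one-dimensional Hausdorff measure of $J$ is $\mathcal{H}^1(J)=2$. 2. $J$ has a tangent line at $\mathcal{H}^1$-almost every point of $J$. 3. $J$ is the graph of a continuous strictly decreasing function $x_2=\psi(x_1)$, $x_1\in[0,1]$. At every junction point $y=f_{\mathbf{j}}(z)$ ($\mathbf{j}$ any finite word) we have $0<y_1<1$, the left-sided derivative of $\psi$ at $y_1$ is $0$, and the right-sided derivative of $\psi$ at $y_1$ is infinite, namely $-\infty$. 4. There is a continuous address map $\pi:\{1,2\}^{\mathbb{N}}\to\mathbb{R}^2$ with $\bigcap_{n\ge 0} f_{i_1\dots i_n}(J)=\{\pi(i_1i_2\dots)\}$ for every sequence. The image $\mu$ under $\pi$ of the product measure $(\tfrac12,\tfrac12)^\infty$ is the unique Borel probability measure on $\mathbb{R}^2$ with $\mu(B)=\tfrac12\mu(f_1^{-1}(B))+\tfrac12\mu(f_2^{-1}(B))$ for all Borel sets $B$. For $\mu$-almost every $y$, we have $y\in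 J$ and $J$ has no tangent line at $y$. -/

import Mathlib

open Set Filter Topology MeasureTheory
open scoped ENNReal

noncomputable section

/-- The Euclidean plane. -/
abbrev Plane : Type := EuclideanSpace ℝ (Fin 2)

/-- The unit points `e₁ = (1,0)` (index `0`) and `e₂ = (0,1)` (index `1`). -/
def unitPt : Fin 2 → Plane
  | 0 => !₂[1, 0]
  | 1 => !₂[0, 1]

/-- The two affine maps with eigenvalues `λ₁, ν₁` and `λ₂, ν₂` (the indices `1, 2` are `0, 1` here):
`f₁ x = (λ₁ x₁ + α x₂ + 1 - λ₁, ν₁ x₂)` and `f₂ x = (ν₂ x₁, β x₁ + λ₂ x₂ + 1 - λ₂)`, with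
`α = ν₂ + λ₁ - 1` and `β = ν₁ + λ₂ - 1`. -/
def curveMap (lam nu : Fin 2 → ℝ) : Fin 2 → Plane → Plane
  | 0 => fun x => !₂[lam 0 * x 0 + (nu 1 + lam 0 - 1) * x 1 + (1 - lam 0), nu 0 * x 1]
  | 1 => fun x => !₂[nu 1 * x 0, (nu 0 + lam 1 - 1) * x 0 + lam 1 * x 1 + (1 - lam 1)]

/-- `e₁` and `e₂` are the fixed points. -/
theorem curveMap_unitPt (lam nu : Fin 2 → ℝ) (i : Fin 2) :
    curveMap lam nu i (unitPt i) = unitPt i := by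
  fin_cases i <;> (ext k; fin_cases k <;> simp [curveMap, unitPt])

/-- The intersection point `z = f₁ e₂` of the two pieces. -/
def junction (lam nu : Fin 2 → ℝ) : Plane := curveMap lam nu 0 (unitPt 1)

/-- `z = f₂ e₁` as well. -/
theorem junction_eq (lam nu : Fin 2 → ℝ) :
    junction lam nu = curveMap lam nu 1 (unitPt 0) := by
  ext k; fin_cases k <;> simp [junction, curveMap, unitPt]

/-- `f_w = f_{w₁} ∘ ⋯ ∘ f_{wₖ}` for a word `w`; the empty word gives the identity. -/
def wordMap (f : Fin 2 → Plane → Plane) : List (Fin 2) → Plane → Plane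
  | [] => id
  | i :: w => f i ∘ wordMap f w

/-- `J` is the self-affine set of the maps `f₁, f₂`: the nonempty compact solution of
`J = f₁(J) ∪ f₂(J)`. -/
structure IsSelfAffineSet (f : Fin 2 → Plane → Plane) (J : Set Plane) : Prop where
  nonempty : J.Nonempty
  isCompact : IsCompact J
  eq_union : J = f 0 '' J ∪ f 1 '' J

/-- `π` is the address map: `⋂ₙ f_{ω₁…ωₙ}(J) = {π ω}` for every sequence `ω`. -/
def IsAddressMap (f : Fin 2 → Plane → Plane) (J : Set Plane) (π : (ℕ → Fin 2) → Plane) : Prop :=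
  ∀ ω : ℕ → Fin 2, ⋂ n : ℕ, wordMap f (List.ofFn fun k : Fin n => ω k) '' J = {π ω}

/-- The product measure `(1/2,1/2)^∞` on sequences. -/
def fairCoin : Measure (ℕ → Fin 2) :=
  Measure.infinitePi fun _ : ℕ => (PMF.uniformOfFintype (Fin 2)).toMeasure

/-- `μ` is a self-similar Borel probability measure with probability vector `(1/2,1/2)`:
`μ(B) = μ(f₁⁻¹ B)/2 + μ(f₂⁻¹ B)/2` for all Borel sets `B`. -/
structure IsHalfSelfSimilar (f : Fin 2 → Plane → Plane) (μ : Measure Plane) : Prop where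
  isProb : IsProbabilityMeasure μ
  eq_sum : ∀ B : Set Plane, MeasurableSet B →
    μ B = 2⁻¹ * μ (f 0 ⁻¹' B) + 2⁻¹ * μ (f 1 ⁻¹' B)

/-- The affine subspace `V` is tangent to the set `B` at the point `x ∈ V ∩ B`. -/
def IsTangentTo (V : AffineSubspace ℝ Plane) (B : Set Plane) (x : Plane) : Prop :=
  x ∈ V ∧ x ∈ B ∧ ∀ δ : ℝ, 0 < δ → ∃ ε : ℝ, 0 < ε ∧
    ∀ b ∈ B \ {x}, dist x b < ε → Metric.infDist b (V : Set Plane) / dist x b < δ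

/-- `B` possesses a tangent line at `x`. -/
def HasTangentLine (B : Set Plane) (x : Plane) : Prop :=
  ∃ V : AffineSubspace ℝ Plane, Module.finrank ℝ V.direction = 1 ∧ IsTangentTo V B x

end

/-!
The maps act diagonally, `f i` multiplying the `j`-th coordinate by `2/3` if `i = j` and by `1/3`
otherwise. So everything is read off from the address map `point`, whose coordinates `coord 0` and
`coord 1` are the address maps of two iterated function systems on the line. Existence, uniqueness
and the address property hold for all contractions (`IsCoding.eq_range`,
`IsCoding.iInter_prefixMap_image`), as does uniqueness of the invariant measure with given weights
(`IsCoding.eq_map_coin`). Comparing addresses at the first difference shows that one coordinate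
strictly decreases when the other increases (`coord_strictAnti`), and that only eventually constant
sequences share their point with another one (`injOn_point`).

*Length.* On the curve the map `x ↦ x₁ - x₂` does not decrease distances, and its image lies in
`[-1, 1]`, so the length is at most `2`. If the letters are chosen with the weights `ratio j`, the
`j`-th coordinate is uniformly distributed on the unit interval, by uniqueness of the invariant
measure. Under these two laws (`j = 0, 1`) the letter `j` has frequency `2/3`, so they live on
disjoint sets of sequences. Each of their images in the curve has length at least `1`, because it
projects to a set of full measure in one of the axes (`hausdorffMeasure_split`). Hence the length is
`2`, and up to a null set the curve consists of these two parts, even after removing sequences of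
probability zero.

*Tangents.* Over each axis the curve is the graph of a monotone function, which is differentiable
almost everywhere. Removing the exceptional parameters from the two parts gives a tangent at almost
every point (`hausdorffMeasure_curve_and_ae_hasTangentLine`).

*Junction points.* At the fixed point `eⱼ` the curve is contracted by `1/3` across and by `2/3`
along the `j`-th axis, so it is tangent to that axis there (`coord_le_pow_mul`). A junction point is
the common image of both end points, which gives the two one-sided derivatives.

*No tangent for the fair measure.* For fair coin tossing the difference of the numbers of letters is
a simple random walk. It returns to zero infinitely often (`ae_exists_walk_eq_zero`), and at these
times `f_{ω₁…ωₙ}` is a homothety. So the curve contains arbitrarily small homothetic copies of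
itself around the point, which excludes a tangent as the curve is not contained in a line
(`not_hasTangentLine`).
-/

namespace SelfAffineCurve

/-! ### Coding by sequences -/

/-- The left shift on sequences. -/
def shift (ω : ℕ → Fin 2) : ℕ → Fin 2 := fun n => ω (n + 1)

/-- The sequence with first letter `i`, followed by `ω`. -/
def cons (i : Fin 2) (ω : ℕ → Fin 2) : ℕ → Fin 2
  | 0 => i
  | n + 1 => ω n

@[simp] theorem cons_zero (i : Fin 2) (ω : ℕ → Fin 2) : cons i ω 0 = i := rfl

@[simp] theorem shift_cons (i : Fin 2) (ω : ℕ → Fin 2) : shift (cons i ω) = ω := rfl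

theorem continuous_shift : Continuous shift := by
  unfold shift; fun_prop

/-- `f_{ω₁} ∘ ⋯ ∘ f_{ωₙ}` for a sequence `ω`. -/
def prefixMap {E : Type*} (f : Fin 2 → E → E) : ℕ → (ℕ → Fin 2) → E → E
  | 0, _ => id
  | n + 1, ω => f (ω 0) ∘ prefixMap f n (shift ω)

theorem prefixMap_succ {E : Type*} (f : Fin 2 → E → E) (n : ℕ) (ω : ℕ → Fin 2) (x : E) :
    prefixMap f (n + 1) ω x = f (ω 0) (prefixMap f n (shift ω) x) := rfl

theorem prefixMap_mem {E : Type*} {f : Fin 2 → E → E} {K : Set E}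
    (hK : ∀ i, MapsTo (f i) K K) (n : ℕ) (ω : ℕ → Fin 2) {x : E} (hx : x ∈ K) :
    prefixMap f n ω x ∈ K := by
  induction n generalizing ω with
  | zero => exact hx
  | succ n ih => exact hK _ (ih _)

/-- `π` conjugates the contractions `f 0, f 1` of ratio at most `2/3` to the two inverse branches of
the shift. -/
structure IsCoding {E : Type*} [MetricSpace E] (f : Fin 2 → E → E) (π : (ℕ → Fin 2) → E) :
    Prop where
  lipschitz : ∀ i, LipschitzWith (2 / 3) (f i)
  continuous : Continuous π
  map_shift : ∀ ω, f (ω 0) (π (shift ω)) = π ω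

theorem dist_prefixMap_le {E : Type*} [MetricSpace E] {f : Fin 2 → E → E}
    (hf : ∀ i, LipschitzWith (2 / 3) (f i)) (n : ℕ) (ω : ℕ → Fin 2) (x y : E) :
    dist (prefixMap f n ω x) (prefixMap f n ω y) ≤ (2 / 3) ^ n * dist x y := by
  induction n generalizing ω with
  | zero => simp [prefixMap]
  | succ n ih =>
    have h1 := (hf (ω 0)).dist_le_mul (prefixMap f n (shift ω) x) (prefixMap f n (shift ω) y)
    have h2 := ih (shift ω)
    simp only [prefixMap_succ]
    push_cast at h1
    rw [pow_succ]
    linarith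

namespace IsCoding

variable {E : Type*} [MetricSpace E] {f : Fin 2 → E → E} {π : (ℕ → Fin 2) → E}

theorem prefixMap_apply (h : IsCoding f π) (n : ℕ) (ω : ℕ → Fin 2) :
    prefixMap f n ω (π (shift^[n] ω)) = π ω := by
  induction n generalizing ω with
  | zero => rfl
  | succ n ih => rw [prefixMap_succ, Function.iterate_succ_apply, ih, h.map_shift]

theorem map_cons (h : IsCoding f π) (i : Fin 2) (ω : ℕ → Fin 2) : π (cons i ω) = f i (π ω) :=
  (h.map_shift (cons i ω)).symm

theorem isCompact_range (h : IsCoding f π) : IsCompact (range π) :=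
  _root_.isCompact_range h.continuous

theorem tendsto_prefixMap (h : IsCoding f π) (ω : ℕ → Fin 2) {x : ℕ → E}
    (hx : Bornology.IsBounded (range x)) :
    Tendsto (fun n => prefixMap f n ω (x n)) atTop (𝓝 (π ω)) := by
  obtain ⟨C, hC⟩ := Metric.isBounded_iff.1 (hx.union h.isCompact_range.isBounded)
  have hpow : Tendsto (fun n : ℕ => (2 / 3 : ℝ) ^ n * C) atTop (𝓝 0) := by
    simpa using (tendsto_pow_atTop_nhds_zero_of_lt_one (by norm_num : (0 : ℝ) ≤ 2 / 3)
      (by norm_num)).mul_const C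
  rw [tendsto_iff_dist_tendsto_zero]
  refine squeeze_zero (fun _ => dist_nonneg) (fun n => ?_) hpow
  rw [← h.prefixMap_apply n ω]
  refine (dist_prefixMap_le h.lipschitz n ω _ _).trans ?_
  gcongr
  exact hC (Or.inl ⟨n, rfl⟩) (Or.inr ⟨_, rfl⟩)

theorem range_eq (h : IsCoding f π) : range π = f 0 '' range π ∪ f 1 '' range π := by
  ext x
  constructor
  · rintro ⟨ω, rfl⟩
    rw [← h.map_shift ω]
    have : ω 0 = 0 ∨ ω 0 = 1 := by omega
    rcases this with h0 | h0 <;> rw [h0]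
    · exact Or.inl ⟨_, ⟨_, rfl⟩, rfl⟩
    · exact Or.inr ⟨_, ⟨_, rfl⟩, rfl⟩
  · rintro (⟨_, ⟨ω, rfl⟩, rfl⟩ | ⟨_, ⟨ω, rfl⟩, rfl⟩)
    · exact ⟨cons 0 ω, h.map_cons 0 ω⟩
    · exact ⟨cons 1 ω, h.map_cons 1 ω⟩

/-- A nonempty closed set that is mapped into itself contains all limits of `f_{ω₁…ωₙ}(x)`. -/
theorem range_subset (h : IsCoding f π) {K : Set E} (hne : K.Nonempty) (hcl : IsClosed K)
    (hK : ∀ i, MapsTo (f i) K K) : range π ⊆ K := by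
  rintro _ ⟨ω, rfl⟩
  obtain ⟨x, hx⟩ := hne
  have ht := h.tendsto_prefixMap ω (x := fun _ => x)
    (Bornology.isBounded_singleton.subset range_const_subset)
  exact hcl.mem_of_tendsto ht (Eventually.of_forall fun n => prefixMap_mem hK n ω hx)

/-- Every bounded set covered by its two images lies in the range of the coding map: a point is
followed backwards through the maps. -/
theorem subset_range (h : IsCoding f π) {K : Set E} (hb : Bornology.IsBounded K)
    (hK : K ⊆ f 0 '' K ∪ f 1 '' K) : K ⊆ range π := by
  have hstep : ∀ x : K, ∃ p : Fin 2 × K, f p.1 p.2 = x := by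
    rintro ⟨x, hx⟩
    rcases hK hx with ⟨y, hy, rfl⟩ | ⟨y, hy, rfl⟩
    · exact ⟨(0, ⟨y, hy⟩), rfl⟩
    · exact ⟨(1, ⟨y, hy⟩), rfl⟩
  choose g hg using hstep
  intro x hx
  let orbit : K → ℕ → K := fun y n => (fun z => (g z).2)^[n] y
  let ω : K → ℕ → Fin 2 := fun y n => (g (orbit y n)).1
  have key : ∀ n (y : K), prefixMap f n (ω y) (orbit y n) = y := by
    intro n
    induction n with
    | zero => intro y; rfl
    | succ n ih =>
      intro y
      rw [prefixMap_succ, ← hg y]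
      exact congrArg (f (g y).1) (ih (g y).2)
  refine ⟨ω ⟨x, hx⟩, tendsto_nhds_unique (h.tendsto_prefixMap (ω ⟨x, hx⟩)
    (x := fun n => (orbit ⟨x, hx⟩ n : E)) (hb.subset ?_)) ?_⟩
  · rintro _ ⟨n, rfl⟩; exact (orbit _ n).2
  · simp only [key]; exact tendsto_const_nhds

theorem eq_range (h : IsCoding f π) {K : Set E} (hne : K.Nonempty) (hK : IsCompact K)
    (heq : K = f 0 '' K ∪ f 1 '' K) : K = range π := by
  refine (h.subset_range hK.isBounded heq.subset).antisymm
    (h.range_subset hne hK.isClosed fun i x hx => ?_)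
  rw [heq]
  have : i = 0 ∨ i = 1 := by omega
  rcases this with rfl | rfl
  · exact Or.inl ⟨x, hx, rfl⟩
  · exact Or.inr ⟨x, hx, rfl⟩

theorem iInter_prefixMap_image (h : IsCoding f π) (ω : ℕ → Fin 2) :
    ⋂ n : ℕ, prefixMap f n ω '' range π = {π ω} := by
  ext x
  simp only [mem_iInter, mem_singleton_iff]
  constructor
  · intro hx
    choose y hy hyx using hx
    refine tendsto_nhds_unique ?_ (h.tendsto_prefixMap ω (x := y)
      (h.isCompact_range.isBounded.subset (range_subset_iff.2 hy)))
    simp only [hyx]; exact tendsto_const_nhds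
  · rintro rfl n
    exact ⟨_, ⟨_, rfl⟩, h.prefixMap_apply n ω⟩

end IsCoding

/-! ### Product measures on sequences and invariant measures -/

/-- The product measure `m^∞` on sequences. -/
noncomputable def coin (m : Measure (Fin 2)) : Measure (ℕ → Fin 2) :=
  Measure.infinitePi fun _ : ℕ => m

instance (m : Measure (Fin 2)) [IsProbabilityMeasure m] : IsProbabilityMeasure (coin m) := by
  unfold coin; infer_instance

theorem measurable_cons : Measurable fun p : Fin 2 × (ℕ → Fin 2) => cons p.1 p.2 := by
  refine measurable_pi_iff.2 fun n => ?_
  cases n with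
  | zero => exact measurable_fst
  | succ n => exact (measurable_pi_apply n).comp measurable_snd

theorem map_cons_coin (m : Measure (Fin 2)) [IsProbabilityMeasure m] :
    (m.prod (coin m)).map (fun p => cons p.1 p.2) = coin m := by
  classical
  refine Measure.eq_infinitePi _ fun s t ht => ?_
  obtain ⟨N, hN⟩ : ∃ N, s ⊆ Finset.range (N + 1) :=
    ⟨s.sup id, fun i hi => Finset.mem_range.2 (Nat.lt_succ_of_le (Finset.le_sup (f := id) hi))⟩
  let t' : ℕ → Set (Fin 2) := fun i => if i ∈ s then t i else univ
  have ht' : ∀ i, MeasurableSet (t' i) := fun i => MeasurableSet.of_discrete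
  have hpre : (fun p : Fin 2 × (ℕ → Fin 2) => cons p.1 p.2) ⁻¹' ((s : Set ℕ).pi t) =
      t' 0 ×ˢ ((Finset.range N : Set ℕ).pi fun i => t' (i + 1)) := by
    ext ⟨i, ω⟩
    simp only [mem_preimage, Set.mem_pi, mem_prod, t', Finset.mem_coe, Finset.mem_range]
    constructor
    · intro h
      refine ⟨?_, fun k _ => ?_⟩
      · split_ifs with h0
        · exact h 0 h0
        · trivial
      · split_ifs with h0
        · exact h (k + 1) h0
        · trivial
    · rintro ⟨h0, h1⟩ k hk
      cases k with
      | zero => simpa [hk] using h0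
      | succ k =>
        have := h1 k (by simpa using hN hk)
        rw [if_pos hk] at this
        exact this
  rw [Measure.map_apply measurable_cons (MeasurableSet.pi s.countable_toSet fun i _ => ht i), hpre,
    Measure.prod_prod, coin, Measure.infinitePi_pi _ fun i _ => ht' (i + 1),
    mul_comm, ← Finset.prod_range_succ' (fun i => m (t' i)) N,
    ← Finset.prod_subset hN]
  · exact Finset.prod_congr rfl fun i hi => by simp [t', hi]
  · intro i _ hi; simp [t', hi]

theorem measurable_prefixMap {E : Type*} [MeasurableSpace E] {f : Fin 2 → E → E}
    (hf : ∀ i, Measurable (f i)) (n : ℕ) :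
    Measurable fun p : (ℕ → Fin 2) × E => prefixMap f n p.1 p.2 := by
  induction n with
  | zero => exact measurable_snd
  | succ n ih =>
    have h1 : Measurable fun q : Fin 2 × E => f q.1 q.2 :=
      measurable_from_prod_countable_right hf
    have h2 : Measurable fun p : (ℕ → Fin 2) × E => (p.1 0, prefixMap f n (shift p.1) p.2) :=
      ((measurable_pi_apply 0).comp measurable_fst).prodMk
        (ih.comp ((continuous_shift.measurable.comp measurable_fst).prodMk measurable_snd))
    exact h1.comp h2

theorem lintegral_coin (m : Measure (Fin 2)) [IsProbabilityMeasure m]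
    {g : (ℕ → Fin 2) → ℝ≥0∞} (hg : Measurable g) :
    ∫⁻ ω, g ω ∂(coin m) = ∫⁻ i, ∫⁻ ω, g (cons i ω) ∂(coin m) ∂m := by
  conv_lhs => rw [← map_cons_coin m]
  rw [lintegral_map hg measurable_cons]
  exact lintegral_prod _ (hg.comp measurable_cons).aemeasurable

section

variable {E : Type*} [MetricSpace E] [MeasurableSpace E] [BorelSpace E]
  {f : Fin 2 → E → E} {π : (ℕ → Fin 2) → E}

theorem IsCoding.measurable (h : IsCoding f π) : Measurable π := h.continuous.measurable

/-- The image of the product measure is invariant. -/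
theorem IsCoding.lintegral_map_coin (h : IsCoding f π) (m : Measure (Fin 2))
    [IsProbabilityMeasure m] {g : E → ℝ≥0∞} (hg : Measurable g) :
    ∫⁻ x, g x ∂((coin m).map π) = ∫⁻ i, ∫⁻ x, g (f i x) ∂((coin m).map π) ∂m := by
  rw [lintegral_map hg h.measurable]
  refine (lintegral_coin m (hg.comp h.measurable)).trans (lintegral_congr fun i => ?_)
  simp only [Function.comp_apply, h.map_cons]
  exact (lintegral_map (hg.comp (h.lipschitz i).continuous.measurable) h.measurable).symm

/-- An invariant probability measure `μ` is the law of `f_{ω₁…ωₙ}(x)` for independent `ω` and `x`,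
and these points converge to `π ω`; hence `μ` is the image of the product measure. -/
theorem IsCoding.eq_map_coin [SecondCountableTopology E] (h : IsCoding f π) (m : Measure (Fin 2))
    [IsProbabilityMeasure m] (μ : Measure E) [IsProbabilityMeasure μ]
    (hμ : ∀ g : E → ℝ≥0∞, Measurable g → ∫⁻ x, g x ∂μ = ∫⁻ i, ∫⁻ x, g (f i x) ∂μ ∂m) :
    μ = (coin m).map π := by
  have hf : ∀ i, Measurable (f i) := fun i => (h.lipschitz i).continuous.measurable
  have key : ∀ n (g : E → ℝ≥0∞), Measurable g →
      ∫⁻ ω, ∫⁻ x, g (prefixMap f n ω x) ∂μ ∂(coin m) = ∫⁻ x, g x ∂μ := by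
    intro n
    induction n with
    | zero => intro g _; simp [prefixMap]
    | succ n ih =>
      intro g hg
      have hmeas : Measurable fun ω => ∫⁻ x, g (prefixMap f (n + 1) ω x) ∂μ :=
        (hg.comp (measurable_prefixMap hf (n + 1))).lintegral_prod_right'
      rw [lintegral_coin m hmeas, hμ g hg]
      exact lintegral_congr fun i => ih (fun x => g (f i x)) (hg.comp (hf i))
  refine ext_of_forall_lintegral_eq_of_IsFiniteMeasure fun g => ?_
  have hg : Measurable fun x => (g x : ℝ≥0∞) := g.continuous.measurable.coe_nnreal_ennreal
  rw [lintegral_map hg h.measurable]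
  have hlim : Tendsto (fun n => ∫⁻ p : (ℕ → Fin 2) × E, (g (prefixMap f n p.1 p.2) : ℝ≥0∞)
      ∂((coin m).prod μ)) atTop (𝓝 (∫⁻ p : (ℕ → Fin 2) × E, (g (π p.1) : ℝ≥0∞)
      ∂((coin m).prod μ))) := by
    refine tendsto_lintegral_of_dominated_convergence (fun _ => (nndist g 0 : ℝ≥0∞))
      (fun n => hg.comp (measurable_prefixMap hf n)) (fun n => ?_) ?_ ?_
    · exact Eventually.of_forall fun p =>
        ENNReal.coe_le_coe.2 (BoundedContinuousFunction.NNReal.upper_bound g _)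
    · simp
    · refine Eventually.of_forall fun p => ?_
      have := h.tendsto_prefixMap p.1 (x := fun _ => p.2)
        (Bornology.isBounded_singleton.subset range_const_subset)
      exact (ENNReal.continuous_coe.tendsto _).comp ((g.continuous.tendsto _).comp this)
  have h1 : ∀ n, ∫⁻ p : (ℕ → Fin 2) × E, (g (prefixMap f n p.1 p.2) : ℝ≥0∞)
      ∂((coin m).prod μ) = ∫⁻ x, (g x : ℝ≥0∞) ∂μ := fun n => by
    exact (lintegral_prod _ (hg.comp (measurable_prefixMap hf n)).aemeasurable).trans (key n _ hg)
  have h2 : ∫⁻ p : (ℕ → Fin 2) × E, (g (π p.1) : ℝ≥0∞) ∂((coin m).prod μ) =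
      ∫⁻ ω, (g (π ω) : ℝ≥0∞) ∂(coin m) := by
    refine (lintegral_prod _ (hg.comp (h.measurable.comp measurable_fst)).aemeasurable).trans ?_
    simp
  simp only [h1, h2] at hlim
  exact tendsto_nhds_unique tendsto_const_nhds hlim

end

/-! ### The curve in coordinates -/

/-- The contraction ratio of the `i`-th map in the `j`-th coordinate. -/
noncomputable def ratio (j i : Fin 2) : ℝ := if i = j then 2 / 3 else 1 / 3

/-- The translation part of the `i`-th map in the `j`-th coordinate. -/
noncomputable def offset (j i : Fin 2) : ℝ := if i = j then 1 / 3 else 0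

/-- The `i`-th map in the `j`-th coordinate. -/
noncomputable def lineMap (j i : Fin 2) (t : ℝ) : ℝ := ratio j i * t + offset j i

theorem lineMap_self (j : Fin 2) (t : ℝ) : lineMap j j t = 2 / 3 * t + 1 / 3 := by
  simp [lineMap, ratio, offset]

theorem lineMap_of_ne {j i : Fin 2} (h : i ≠ j) (t : ℝ) : lineMap j i t = 1 / 3 * t := by
  simp [lineMap, ratio, offset, h]

theorem ratio_pos (j i : Fin 2) : 0 < ratio j i := by
  unfold ratio; split_ifs <;> norm_num

theorem ratio_le (j i : Fin 2) : ratio j i ≤ 2 / 3 := by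
  unfold ratio; split_ifs <;> norm_num

theorem offset_nonneg (j i : Fin 2) : 0 ≤ offset j i := by
  unfold offset; split_ifs <;> norm_num

theorem offset_le (j i : Fin 2) : offset j i ≤ 1 / 3 := by
  unfold offset; split_ifs <;> norm_num

theorem eq_or_eq_of_ne {j k : Fin 2} (h : j ≠ k) (i : Fin 2) : i = j ∨ i = k := by omega

theorem lipschitzWith_lineMap (j i : Fin 2) : LipschitzWith (2 / 3) (lineMap j i) := by
  refine LipschitzWith.of_dist_le_mul fun x y => ?_
  simp only [lineMap, Real.dist_eq]
  rw [show ratio j i * x + offset j i - (ratio j i * y + offset j i) = ratio j i * (x - y) by ring,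
    abs_mul, abs_of_pos (ratio_pos j i)]
  push_cast
  exact mul_le_mul_of_nonneg_right (ratio_le j i) (abs_nonneg _)

/-- The ratio of `f_{ω₁…ωₙ}` in the `j`-th coordinate. -/
noncomputable def scale (j : Fin 2) (n : ℕ) (ω : ℕ → Fin 2) : ℝ :=
  ∏ k ∈ Finset.range n, ratio j (ω k)

theorem scale_pos (j : Fin 2) (n : ℕ) (ω : ℕ → Fin 2) : 0 < scale j n ω :=
  Finset.prod_pos fun _ _ => ratio_pos _ _

theorem scale_le (j : Fin 2) (n : ℕ) (ω : ℕ → Fin 2) : scale j n ω ≤ (2 / 3) ^ n := by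
  unfold scale
  refine (Finset.prod_le_prod (fun k _ => (ratio_pos j (ω k)).le)
    (fun k _ => ratio_le j (ω k))).trans_eq ?_
  rw [Finset.prod_const, Finset.card_range]

theorem scale_succ (j : Fin 2) (n : ℕ) (ω : ℕ → Fin 2) :
    scale j (n + 1) ω = ratio j (ω 0) * scale j n (shift ω) := by
  rw [scale, Finset.prod_range_succ', mul_comm]; rfl

/-- The `j`-th coordinate of the point with address `ω`. -/
noncomputable def coord (j : Fin 2) (ω : ℕ → Fin 2) : ℝ :=
  ∑' n, scale j n ω * offset j (ω n)

theorem norm_term_le (j : Fin 2) (n : ℕ) (ω : ℕ → Fin 2) :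
    ‖scale j n ω * offset j (ω n)‖ ≤ (2 / 3) ^ n := by
  rw [Real.norm_eq_abs, abs_of_nonneg (mul_nonneg (scale_pos j n ω).le (offset_nonneg _ _))]
  nlinarith [scale_le j n ω, scale_pos j n ω, offset_le j (ω n), offset_nonneg j (ω n)]

theorem summable_geometric : Summable fun n : ℕ => (2 / 3 : ℝ) ^ n :=
  summable_geometric_of_lt_one (by norm_num) (by norm_num)

theorem summable_coord (j : Fin 2) (ω : ℕ → Fin 2) :
    Summable fun n => scale j n ω * offset j (ω n) :=
  .of_norm_bounded summable_geometric fun n => norm_term_le j n ω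

theorem continuous_coord (j : Fin 2) : Continuous (coord j) := by
  refine continuous_tsum (fun n => ?_) summable_geometric fun n ω => norm_term_le j n ω
  have h (g : Fin 2 → ℝ) (k : ℕ) : Continuous fun ω : ℕ → Fin 2 => g (ω k) :=
    continuous_of_discreteTopology.comp (continuous_apply k)
  exact (continuous_finsetProd _ fun k _ => h (ratio j) k).mul (h (offset j) n)

theorem coord_shift (j : Fin 2) (ω : ℕ → Fin 2) :
    lineMap j (ω 0) (coord j (shift ω)) = coord j ω := by
  rw [coord, coord, (summable_coord j ω).tsum_eq_zero_add, lineMap, ← tsum_mul_left, add_comm]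
  congr 1
  · simp [scale]
  · refine tsum_congr fun n => ?_
    rw [scale_succ, mul_assoc]; rfl

theorem isCoding_coord (j : Fin 2) : IsCoding (lineMap j) (coord j) where
  lipschitz := lipschitzWith_lineMap j
  continuous := continuous_coord j
  map_shift := coord_shift j

/-- The two maps with `λ₁ = λ₂ = 2/3` and `ν₁ = ν₂ = 1/3`; they act diagonally. -/
noncomputable def planeMap : Fin 2 → Plane → Plane := curveMap (fun _ => 2 / 3) fun _ => 1 / 3

theorem planeMap_apply (i j : Fin 2) (x : Plane) : planeMap i x j = lineMap j i (x j) := by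
  fin_cases i <;> fin_cases j <;>
    norm_num [planeMap, curveMap, lineMap, ratio, offset] <;> rfl

/-- The point with address `ω`. -/
noncomputable def point (ω : ℕ → Fin 2) : Plane := !₂[coord 0 ω, coord 1 ω]

@[simp] theorem point_apply (ω : ℕ → Fin 2) (j : Fin 2) : point ω j = coord j ω := by
  fin_cases j <;> rfl

theorem plane_ext {j k : Fin 2} (hjk : j ≠ k) {x y : Plane} (hj : x j = y j) (hk : x k = y k) :
    x = y := by
  ext i
  rcases eq_or_eq_of_ne hjk i with rfl | rfl <;> assumption

theorem isCoding_point : IsCoding planeMap point where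
  lipschitz i := by
    refine LipschitzWith.of_dist_le_mul fun x y => ?_
    have h (j : Fin 2) : dist (planeMap i x j) (planeMap i y j) ^ 2 ≤
        (2 / 3) ^ 2 * dist (x j) (y j) ^ 2 := by
      rw [← mul_pow, planeMap_apply, planeMap_apply]
      exact pow_le_pow_left₀ dist_nonneg
        (by simpa using (lipschitzWith_lineMap j i).dist_le_mul (x j) (y j)) 2
    rw [EuclideanSpace.dist_eq, EuclideanSpace.dist_eq]
    push_cast
    rw [show (2 / 3 : ℝ) = √((2 / 3) ^ 2) by rw [Real.sqrt_sq]; norm_num,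
      ← Real.sqrt_mul (by positivity), Finset.mul_sum]
    exact Real.sqrt_le_sqrt (Finset.sum_le_sum fun j _ => h j)
  continuous := by
    have := continuous_coord 0
    have := continuous_coord 1
    unfold point
    exact (PiLp.continuous_toLp 2 _).comp (by fun_prop)
  map_shift ω := by
    ext j
    rw [planeMap_apply, point_apply, point_apply, coord_shift]

/-- The self-affine curve. -/
def curve : Set Plane := range point

theorem isCompact_curve : IsCompact curve := isCoding_point.isCompact_range

theorem planeMap_mem_curve (i : Fin 2) {x : Plane} (hx : x ∈ curve) : planeMap i x ∈ curve := by
  obtain ⟨ω, rfl⟩ := hx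
  exact ⟨cons i ω, isCoding_point.map_cons i ω⟩

theorem isSelfAffineSet_curve : IsSelfAffineSet planeMap curve where
  nonempty := range_nonempty _
  isCompact := isCompact_curve
  eq_union := isCoding_point.range_eq

theorem coord_cons (j i : Fin 2) (ω : ℕ → Fin 2) :
    coord j (cons i ω) = lineMap j i (coord j ω) := (isCoding_coord j).map_cons i ω

theorem coord_prefix (j : Fin 2) (n : ℕ) (ω : ℕ → Fin 2) (x : Plane) :
    prefixMap planeMap n ω x j = coord j ω + scale j n ω * (x j - coord j (shift^[n] ω)) := by
  induction n generalizing ω with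
  | zero => simp [prefixMap, scale]
  | succ n ih =>
    rw [prefixMap_succ, planeMap_apply, ih, ← coord_shift j ω, scale_succ,
      Function.iterate_succ_apply, lineMap, lineMap]
    ring

/-- The triangle with vertices `(0,0)`, `(1,0)`, `(0,1)` is mapped into itself, so it contains the
curve. -/
theorem coord_mem_triangle (ω : ℕ → Fin 2) :
    0 ≤ coord 0 ω ∧ 0 ≤ coord 1 ω ∧ coord 0 ω + coord 1 ω ≤ 1 := by
  have h := isCoding_point.range_subset
    (K := {x : Plane | 0 ≤ x 0} ∩ ({x | 0 ≤ x 1} ∩ {x | x 0 + x 1 ≤ 1})) ⟨0, by simp⟩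
    ((isClosed_le (by fun_prop) (by fun_prop)).inter ((isClosed_le (by fun_prop)
      (by fun_prop)).inter (isClosed_le (by fun_prop) (by fun_prop)))) ?_ ⟨ω, rfl⟩
  · simpa using h
  · rintro i x ⟨h0, h1, h2⟩
    simp only [mem_ofPred_eq] at h0 h1 h2
    simp only [mem_inter_iff, mem_ofPred_eq, planeMap_apply]
    fin_cases i <;> simp [lineMap, ratio, offset] <;> refine ⟨?_, ?_, ?_⟩ <;> linarith

theorem coord_nonneg (j : Fin 2) (ω : ℕ → Fin 2) : 0 ≤ coord j ω := by
  obtain ⟨h0, h1, -⟩ := coord_mem_triangle ω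
  fin_cases j <;> assumption

theorem coord_add_le {j k : Fin 2} (hjk : j ≠ k) (ω : ℕ → Fin 2) :
    coord j ω + coord k ω ≤ 1 := by
  have h := (coord_mem_triangle ω).2.2
  have : j = 0 ∧ k = 1 ∨ j = 1 ∧ k = 0 := by omega
  rcases this with ⟨rfl, rfl⟩ | ⟨rfl, rfl⟩ <;> linarith

theorem coord_le_one (j : Fin 2) (ω : ℕ → Fin 2) : coord j ω ≤ 1 := by
  obtain ⟨h0, h1, h2⟩ := coord_mem_triangle ω
  fin_cases j <;> simp <;> linarith

theorem coord_of_eq {j : Fin 2} {ω : ℕ → Fin 2} (h : ω 0 = j) :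
    coord j ω = 2 / 3 * coord j (shift ω) + 1 / 3 := by
  rw [← coord_shift, h, lineMap_self]

theorem coord_of_ne {j : Fin 2} {ω : ℕ → Fin 2} (h : ω 0 ≠ j) :
    coord j ω = 1 / 3 * coord j (shift ω) := by
  rw [← coord_shift, lineMap_of_ne h]

theorem third_le_coord {j : Fin 2} {ω : ℕ → Fin 2} (h : ω 0 = j) : 1 / 3 ≤ coord j ω := by
  rw [coord_of_eq h]; linarith [coord_nonneg j (shift ω)]

theorem coord_le_third {j : Fin 2} {ω : ℕ → Fin 2} (h : ω 0 ≠ j) : coord j ω ≤ 1 / 3 := by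
  rw [coord_of_ne h]; linarith [coord_le_one j (shift ω)]

theorem coord_const_self (j : Fin 2) : coord j (fun _ => j) = 1 := by
  have h := coord_of_eq (j := j) (ω := fun _ => j) rfl
  rw [show shift (fun _ => j) = fun _ => j from rfl] at h
  linarith

theorem coord_const_of_ne {j k : Fin 2} (h : j ≠ k) : coord k (fun _ => j) = 0 := by
  have h := coord_of_ne (j := k) (ω := fun _ => j) h
  rw [show shift (fun _ => j) = fun _ => j from rfl] at h
  linarith

/-- The only point with vanishing `k`-th coordinate is the fixed point of the other map. -/
theorem eq_const_of_coord_eq_zero {j k : Fin 2} (hjk : j ≠ k) {ω : ℕ → Fin 2}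
    (h : coord k ω = 0) : ω = fun _ => j := by
  have h0 (τ : ℕ → Fin 2) (hτ : coord k τ = 0) : τ 0 = j ∧ coord k (shift τ) = 0 := by
    rcases eq_or_eq_of_ne hjk (τ 0) with h0 | h0
    · refine ⟨h0, ?_⟩
      have := coord_of_ne (j := k) (ω := τ) (h0 ▸ hjk)
      linarith
    · linarith [third_le_coord h0]
  funext n
  induction n generalizing ω with
  | zero => exact (h0 ω h).1
  | succ n ih => exact ih (ω := shift ω) (h0 ω h).2

theorem eq_const_of_coord_eq_one {j k : Fin 2} (hjk : j ≠ k) {ω : ℕ → Fin 2}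
    (h : coord j ω = 1) : ω = fun _ => j :=
  eq_const_of_coord_eq_zero hjk (by linarith [coord_add_le hjk ω, coord_nonneg k ω])

theorem coord_antitone_of_head_ne {j k : Fin 2} (hjk : j ≠ k) {ω τ : ℕ → Fin 2}
    (h0 : ω 0 ≠ τ 0) (h : coord j ω ≤ coord j τ) : coord k τ ≤ coord k ω := by
  rcases eq_or_eq_of_ne hjk (ω 0) with hω | hω
  · -- in this case both points are the common point of the two pieces
    have hω' : ω 0 ≠ k := by rwa [hω]
    have hτ' : τ 0 ≠ j := by rwa [← hω, ne_comm]
    have h1 := third_le_coord hω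
    have h2 := coord_le_third hτ'
    have h3 := coord_of_eq hω
    have h5 := eq_const_of_coord_eq_zero hjk.symm (ω := shift ω) (by linarith)
    have h6 := coord_of_ne hω'
    have h7 := coord_of_eq ((eq_or_eq_of_ne hjk (τ 0)).resolve_left hτ')
    have h8 := coord_add_le hjk (shift τ)
    have h9 := coord_of_ne hτ'
    rw [h5, coord_const_self] at h6
    linarith
  · have hτ' : τ 0 ≠ k := by rwa [← hω, ne_comm]
    linarith [third_le_coord hω, coord_le_third hτ']

theorem lineMap_le_lineMap_iff (j i : Fin 2) {s t : ℝ} :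
    lineMap j i s ≤ lineMap j i t ↔ s ≤ t := by
  simp [lineMap, mul_le_mul_iff_right₀ (ratio_pos j i)]

/-- The curve is the graph of a decreasing function over each coordinate axis. -/
theorem coord_antitone {j k : Fin 2} (hjk : j ≠ k) {ω τ : ℕ → Fin 2}
    (h : coord j ω ≤ coord j τ) : coord k τ ≤ coord k ω := by
  by_cases hne : ω = τ
  · rw [hne]
  obtain ⟨n, hn⟩ := Function.ne_iff.1 hne
  clear hne
  induction n generalizing ω τ with
  | zero => exact coord_antitone_of_head_ne hjk hn h
  | succ n ih =>
    by_cases h0 : ω 0 = τ 0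
    · rw [← coord_shift j ω, ← coord_shift j τ, h0, lineMap_le_lineMap_iff] at h
      rw [← coord_shift k ω, ← coord_shift k τ, h0, lineMap_le_lineMap_iff]
      exact ih h hn
    · exact coord_antitone_of_head_ne hjk h0 h

theorem coord_eq_of_coord_eq {j k : Fin 2} (hjk : j ≠ k) {ω τ : ℕ → Fin 2}
    (h : coord j ω = coord j τ) : coord k ω = coord k τ :=
  (coord_antitone hjk h.ge).antisymm (coord_antitone hjk h.le)

theorem coord_strictAnti {j k : Fin 2} (hjk : j ≠ k) {ω τ : ℕ → Fin 2}
    (h : coord j ω < coord j τ) : coord k τ < coord k ω :=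
  (coord_antitone hjk h.le).lt_of_ne fun he => h.ne' (coord_eq_of_coord_eq hjk.symm he)

/-- Sequences that are eventually constant. -/
def IsEventuallyConst (ω : ℕ → Fin 2) : Prop := ∃ i N, ∀ n, N ≤ n → ω n = i

theorem IsEventuallyConst.of_shift {ω : ℕ → Fin 2} (h : IsEventuallyConst (shift ω)) :
    IsEventuallyConst ω := by
  obtain ⟨i, N, h⟩ := h
  refine ⟨i, N + 1, fun n hn => ?_⟩
  obtain ⟨m, rfl⟩ : ∃ m, n = m + 1 := ⟨n - 1, by omega⟩
  exact h m (by omega)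

/-- Two different addresses of one point are eventually constant: the two pieces of the curve only
meet in the common image of the end points. -/
theorem isEventuallyConst_of_coord_eq {ω τ : ℕ → Fin 2} (hne : ω ≠ τ)
    (h : coord 0 ω = coord 0 τ) : IsEventuallyConst ω := by
  have hhead : ∀ ω τ : ℕ → Fin 2, ω 0 ≠ τ 0 → coord 0 ω = coord 0 τ → IsEventuallyConst ω := by
    intro ω τ h0 h
    have h01 : (0 : Fin 2) ≠ 1 := by decide
    apply IsEventuallyConst.of_shift
    by_cases hω : ω 0 = 0
    · have hτ : τ 0 ≠ 0 := by rwa [← hω, ne_comm]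
      have := eq_const_of_coord_eq_zero h01.symm (ω := shift ω)
        (by linarith [third_le_coord hω, coord_le_third hτ, coord_of_eq hω])
      exact ⟨1, 0, fun n _ => congrFun this n⟩
    · have hτ : τ 0 = 0 := by omega
      have := eq_const_of_coord_eq_one h01 (ω := shift ω)
        (by linarith [third_le_coord hτ, coord_le_third hω, coord_of_ne hω])
      exact ⟨0, 0, fun n _ => congrFun this n⟩
  obtain ⟨n, hn⟩ := Function.ne_iff.1 hne
  clear hne
  induction n generalizing ω τ with
  | zero => exact hhead ω τ hn h
  | succ n ih =>
    by_cases h0 : ω 0 = τ 0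
    · rw [← coord_shift 0 ω, ← coord_shift 0 τ, h0] at h
      exact (ih (ω := shift ω) (τ := shift τ)
        (((lineMap_le_lineMap_iff _ _).1 h.le).antisymm
          ((lineMap_le_lineMap_iff _ _).1 h.ge)) hn).of_shift
    · exact hhead ω τ h0 h

theorem injOn_point : InjOn point {ω | ¬ IsEventuallyConst ω} := by
  intro ω hω τ _ h
  by_contra hne
  exact hω (isEventuallyConst_of_coord_eq hne (by simpa using congrArg (fun x : Plane => x 0) h))

/-! ### Lebesgue measure as the law of a coordinate -/

/-- The law on letters whose weights are the contraction ratios in the `j`-th coordinate. -/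
noncomputable def bias (j : Fin 2) : Measure (Fin 2) :=
  ∑ i, ENNReal.ofReal (ratio j i) • Measure.dirac i

theorem ratio_add {j k : Fin 2} (hjk : j ≠ k) : ratio j j + ratio j k = 1 := by
  simp [ratio, hjk.symm]; norm_num

instance (j : Fin 2) : IsProbabilityMeasure (bias j) where
  measure_univ := by
    have h : ratio j 0 + ratio j 1 = 1 := by
      fin_cases j
      · exact ratio_add (by decide)
      · rw [add_comm]; exact ratio_add (by decide)
    simp only [bias, Fin.sum_univ_two, Measure.add_apply, Measure.smul_apply, measure_univ,
      smul_eq_mul, mul_one]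
    rw [← ENNReal.ofReal_add (ratio_pos _ _).le (ratio_pos _ _).le, h, ENNReal.ofReal_one]

theorem lintegral_bias {j k : Fin 2} (hjk : j ≠ k) (g : Fin 2 → ℝ≥0∞) :
    ∫⁻ i, g i ∂(bias j) = ENNReal.ofReal (ratio j k) * g k + ENNReal.ofReal (ratio j j) * g j := by
  have h : ∫⁻ i, g i ∂(bias j) =
      ENNReal.ofReal (ratio j 0) * g 0 + ENNReal.ofReal (ratio j 1) * g 1 := by
    simp [bias, Fin.sum_univ_two, lintegral_add_measure, lintegral_smul_measure]
  rw [h]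
  have : j = 0 ∧ k = 1 ∨ j = 1 ∧ k = 0 := by omega
  rcases this with ⟨rfl, rfl⟩ | ⟨rfl, rfl⟩
  · rw [add_comm]
  · rfl

theorem setLIntegral_lineMap (j i : Fin 2) (s : Set ℝ) (hs : MeasurableSet s) (g : ℝ → ℝ≥0∞) :
    ∫⁻ x in lineMap j i '' s, g x = ENNReal.ofReal (ratio j i) * ∫⁻ x in s, g (lineMap j i x) := by
  have hd : ∀ x ∈ s, HasDerivWithinAt (lineMap j i) (ratio j i) s x := fun x _ => by
    have h := (((hasDerivAt_id x).const_mul (ratio j i)).add_const (offset j i)).hasDerivWithinAt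
      (s := s)
    rwa [mul_one] at h
  have hinj : InjOn (lineMap j i) s := fun x _ y _ h =>
    ((lineMap_le_lineMap_iff j i).1 h.le).antisymm ((lineMap_le_lineMap_iff j i).1 h.ge)
  rw [lintegral_image_eq_lintegral_abs_deriv_mul hs hd hinj, abs_of_pos (ratio_pos j i),
    lintegral_const_mul' _ _ ENNReal.ofReal_ne_top]

theorem lineMap_image_Ioc (j i : Fin 2) (a b : ℝ) :
    lineMap j i '' Ioc a b = Ioc (lineMap j i a) (lineMap j i b) := by
  ext y
  have hr := ratio_pos j i
  constructor
  · rintro ⟨x, ⟨h1, h2⟩, rfl⟩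
    exact ⟨lt_of_not_ge fun h => h1.not_ge ((lineMap_le_lineMap_iff j i).1 h),
      (lineMap_le_lineMap_iff j i).2 h2⟩
  · rintro ⟨h1, h2⟩
    simp only [lineMap] at h1 h2
    refine ⟨(y - offset j i) / ratio j i, ⟨?_, ?_⟩, ?_⟩
    · rw [lt_div_iff₀ hr]; linarith
    · rw [div_le_iff₀ hr]; linarith
    · rw [lineMap]; field_simp; ring

/-- The weights are chosen so that the `j`-th coordinate is uniformly distributed. -/
theorem map_coord_coin_bias (j : Fin 2) :
    (coin (bias j)).map (coord j) = volume.restrict (Ioc (0 : ℝ) 1) := by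
  have : IsProbabilityMeasure (volume.restrict (Ioc (0 : ℝ) 1)) := ⟨by simp⟩
  refine ((isCoding_coord j).eq_map_coin (bias j) _ fun g hg => ?_).symm
  obtain ⟨k, hjk⟩ : ∃ k, j ≠ k := ⟨1 - j, by omega⟩
  rw [lintegral_bias hjk, ← setLIntegral_lineMap _ _ _ measurableSet_Ioc,
    ← setLIntegral_lineMap _ _ _ measurableSet_Ioc, lineMap_image_Ioc, lineMap_image_Ioc,
    lineMap_self, lineMap_self, lineMap_of_ne hjk.symm, lineMap_of_ne hjk.symm,
    show (1 / 3 * 0 : ℝ) = 0 by norm_num, show (1 / 3 * 1 : ℝ) = 1 / 3 by norm_num,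
    show (2 / 3 * 0 + 1 / 3 : ℝ) = 1 / 3 by norm_num, show (2 / 3 * 1 + 1 / 3 : ℝ) = 1 by norm_num,
    ← lintegral_union measurableSet_Ioc (Ioc_disjoint_Ioc_of_le le_rfl),
    Ioc_union_Ioc_eq_Ioc (by norm_num) (by norm_num)]

/-! ### Letter frequencies -/

/-- The sequences in which the letter `j` has frequency `c`. -/
def freqSet (j : Fin 2) (c : ℝ) : Set (ℕ → Fin 2) :=
  {ω | Tendsto (fun n : ℕ => (∑ i ∈ Finset.range n, if ω i = j then (1 : ℝ) else 0) / n)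
    atTop (𝓝 c)}

theorem continuous_letter (g : Fin 2 → ℝ) (k : ℕ) : Continuous fun ω : ℕ → Fin 2 => g (ω k) :=
  continuous_of_discreteTopology.comp (continuous_apply k)

theorem map_letter_coin (m : Measure (Fin 2)) [IsProbabilityMeasure m] (n : ℕ) :
    (coin m).map (fun ω => ω n) = m :=
  Measure.infinitePi_map_eval (fun _ : ℕ => m) n

theorem integral_letter (m : Measure (Fin 2)) [IsProbabilityMeasure m] (g : Fin 2 → ℝ) (n : ℕ) :
    ∫ ω, g (ω n) ∂(coin m) = ∫ i, g i ∂m := by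
  conv_rhs => rw [← map_letter_coin m n]
  exact (integral_map (measurable_pi_apply n).aemeasurable
    (measurable_of_finite g).aestronglyMeasurable).symm

/-- The strong law of large numbers. -/
theorem ae_mem_freqSet (m : Measure (Fin 2)) [IsProbabilityMeasure m] (j : Fin 2) :
    ∀ᵐ ω ∂(coin m), ω ∈ freqSet j (m.real {j}) := by
  let g : Fin 2 → ℝ := fun i => if i = j then 1 else 0
  have hg : Measurable g := measurable_of_finite g
  have hind : ProbabilityTheory.iIndepFun (fun (n : ℕ) (ω : ℕ → Fin 2) => g (ω n)) (coin m) :=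
    ProbabilityTheory.iIndepFun_infinitePi (P := fun _ => m) (X := fun _ => g) fun _ => hg
  have hmap (n : ℕ) : (coin m).map (fun ω => g (ω n)) = m.map g := by
    conv_rhs => rw [← map_letter_coin m n, Measure.map_map hg (measurable_pi_apply n)]
    rfl
  have hmeas (n : ℕ) : Measurable fun ω : ℕ → Fin 2 => g (ω n) := (continuous_letter g n).measurable
  have h := ProbabilityTheory.strong_law_ae_real (μ := coin m) (fun n ω => g (ω n))
    (Integrable.of_bound (hmeas 0).aestronglyMeasurable 1
      (Eventually.of_forall fun ω => by dsimp only [g]; split_ifs <;> simp))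
    (fun i k hik => hind.indepFun hik)
    (fun i => ⟨(hmeas i).aemeasurable, (hmeas 0).aemeasurable, by rw [hmap, hmap]⟩)
  have hint : ∫ ω, g (ω 0) ∂(coin m) = m.real {j} := by
    have h2 : g = indicator {j} 1 := by
      funext i; simp [g, indicator_apply]
    rw [integral_letter, h2, integral_indicator_one (measurableSet_singleton j)]
  rw [hint] at h
  exact h

theorem freqSet_not_eventuallyConst {j : Fin 2} {c : ℝ} (h0 : c ≠ 0) (h1 : c ≠ 1)
    {ω : ℕ → Fin 2} (h : ω ∈ freqSet j c) : ¬ IsEventuallyConst ω := by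
  rintro ⟨i, N, hN⟩
  have hlim : Tendsto (fun n => if ω n = j then (1 : ℝ) else 0) atTop
      (𝓝 (if i = j then 1 else 0)) :=
    tendsto_const_nhds.congr' ((eventually_ge_atTop N).mono fun n hn => by simp [hN n hn])
  have h2 := tendsto_nhds_unique (h.congr fun n => div_eq_inv_mul _ _) hlim.cesaro
  split_ifs at h2 <;> contradiction

theorem disjoint_freqSet {j k : Fin 2} (hjk : j ≠ k) :
    Disjoint (freqSet j (2 / 3)) (freqSet k (2 / 3)) := by
  refine disjoint_left.2 fun ω hj hk => ?_
  have h : Tendsto (fun n : ℕ => (n : ℝ) / n) atTop (𝓝 (2 / 3 + 2 / 3)) := by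
    refine (hj.add hk).congr fun n => ?_
    rw [← add_div, ← Finset.sum_add_distrib]
    congr 1
    rw [Finset.sum_congr rfl (g := fun _ => (1 : ℝ)) fun i _ => ?_]
    · simp
    · rcases eq_or_eq_of_ne hjk (ω i) with h | h <;> simp [h, hjk, hjk.symm]
  have h1 : Tendsto (fun n : ℕ => (n : ℝ) / n) atTop (𝓝 1) :=
    tendsto_const_nhds.congr' ((eventually_ne_atTop 0).mono fun n hn =>
      (div_self (Nat.cast_ne_zero.2 hn)).symm)
  have := tendsto_nhds_unique h h1
  norm_num at this

theorem bias_real_singleton (j : Fin 2) : (bias j).real {j} = 2 / 3 := by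
  obtain ⟨k, hjk⟩ : ∃ k, j ≠ k := ⟨1 - j, by omega⟩
  have h := lintegral_bias hjk (indicator {j} 1)
  rw [lintegral_indicator_one (measurableSet_singleton j)] at h
  simp only [indicator, mem_singleton_iff, hjk.symm, if_false, if_true, Pi.one_apply, mul_zero,
    zero_add, mul_one] at h
  rw [measureReal_def, h, ENNReal.toReal_ofReal (ratio_pos j j).le]
  simp [ratio]

/-! ### The length of the curve -/

theorem abs_apply_sub_le_dist (x y : Plane) (j : Fin 2) : |x j - y j| ≤ dist x y := by
  rw [dist_eq_norm, ← Real.norm_eq_abs]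
  exact PiLp.norm_apply_le (x - y) j

theorem dist_le_abs_add_abs {j k : Fin 2} (hjk : j ≠ k) (x y : Plane) :
    dist x y ≤ |x j - y j| + |x k - y k| := by
  rw [EuclideanSpace.dist_eq]
  refine Real.sqrt_le_iff.2 ⟨by positivity, ?_⟩
  have h : ∑ i, dist (x i) (y i) ^ 2 = |x j - y j| ^ 2 + |x k - y k| ^ 2 := by
    have : j = 0 ∧ k = 1 ∨ j = 1 ∧ k = 0 := by omega
    rw [Fin.sum_univ_two]
    rcases this with ⟨rfl, rfl⟩ | ⟨rfl, rfl⟩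
    · rfl
    · exact add_comm _ _
  rw [h]
  nlinarith [abs_nonneg (x j - y j), abs_nonneg (x k - y k)]

/-- Since one coordinate increases where the other decreases, the map `x ↦ x₁ - x₂` does not
shorten distances on the curve. -/
theorem dist_point_le (ω τ : ℕ → Fin 2) :
    dist (point ω) (point τ) ≤ dist (coord 0 ω - coord 1 ω) (coord 0 τ - coord 1 τ) := by
  have h01 : (0 : Fin 2) ≠ 1 := by decide
  refine (dist_le_abs_add_abs h01 _ _).trans ?_
  simp only [point_apply, Real.dist_eq]
  rcases le_total (coord 0 ω) (coord 0 τ) with h | h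
  · have h' := coord_antitone h01 h
    rw [abs_of_nonpos (by linarith), abs_of_nonneg (by linarith), abs_of_nonpos (by linarith)]
    linarith
  · have h' := coord_antitone h01 h
    rw [abs_of_nonneg (by linarith), abs_of_nonpos (by linarith), abs_of_nonneg (by linarith)]
    linarith

theorem hausdorffMeasure_curve_le : Measure.hausdorffMeasure 1 curve ≤ 2 := by
  let d : (ℕ → Fin 2) → ℝ := fun ω => coord 0 ω - coord 1 ω
  have hsec : ∀ s ∈ range d, ∃ ω, d ω = s := fun s hs => hs
  choose! g hg using hsec
  have hlip : LipschitzOnWith 1 (fun s => point (g s)) (range d) := by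
    refine LipschitzOnWith.of_dist_le_mul fun s hs t ht => ?_
    have := dist_point_le (g s) (g t)
    rw [show coord 0 (g s) - coord 1 (g s) = s from hg s hs,
      show coord 0 (g t) - coord 1 (g t) = t from hg t ht] at this
    simpa using this
  have himage : curve ⊆ (fun s => point (g s)) '' range d := by
    rintro _ ⟨ω, rfl⟩
    refine ⟨d ω, ⟨ω, rfl⟩, ?_⟩
    have h1 := dist_point_le (g (d ω)) ω
    rw [show coord 0 (g (d ω)) - coord 1 (g (d ω)) = coord 0 ω - coord 1 ω from hg (d ω) ⟨ω, rfl⟩,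
      dist_self] at h1
    exact dist_le_zero.1 h1
  have hd : range d ⊆ Icc (-1) 1 := by
    rintro _ ⟨ω, rfl⟩
    constructor <;>
      linarith [coord_nonneg 0 ω, coord_nonneg 1 ω, coord_le_one 0 ω, coord_le_one 1 ω]
  calc Measure.hausdorffMeasure 1 curve
      ≤ Measure.hausdorffMeasure 1 ((fun s => point (g s)) '' range d) := measure_mono himage
    _ ≤ Measure.hausdorffMeasure 1 (range d) := by
      simpa using hlip.hausdorffMeasure_image_le zero_le_one
    _ ≤ volume (Icc (-1 : ℝ) 1) := by rw [hausdorffMeasure_real]; exact measure_mono hd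
    _ = 2 := by rw [Real.volume_Icc]; norm_num

/-- The length of a part of the curve is at least the length of its projection to the `j`-th
axis. -/
theorem coin_bias_le_hausdorffMeasure (j : Fin 2) (S : Set (ℕ → Fin 2)) :
    coin (bias j) S ≤ Measure.hausdorffMeasure 1 (point '' S) := by
  have hlip : LipschitzOnWith 1 (fun x : Plane => x j) (point '' S) :=
    LipschitzOnWith.of_dist_le_mul fun x _ y _ => by
      simpa [Real.dist_eq] using abs_apply_sub_le_dist x y j
  calc coin (bias j) S ≤ coin (bias j) (coord j ⁻¹' (coord j '' S)) :=
      measure_mono (subset_preimage_image _ _)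
    _ ≤ (coin (bias j)).map (coord j) (coord j '' S) :=
      Measure.le_map_apply (continuous_coord j).aemeasurable _
    _ ≤ volume (coord j '' S) := by
      rw [map_coord_coin_bias]; exact Measure.restrict_apply_le _ _
    _ = Measure.hausdorffMeasure 1 ((fun x : Plane => x j) '' (point '' S)) := by
      rw [hausdorffMeasure_real, image_image]; simp
    _ ≤ Measure.hausdorffMeasure 1 (point '' S) := by
      simpa using hlip.hausdorffMeasure_image_le zero_le_one

/-- The horizontal and the vertical half of the length are carried by disjoint sets, on which the
letters have different frequencies. -/
theorem hausdorffMeasure_split (S : Fin 2 → Set (ℕ → Fin 2)) (hm : ∀ j, MeasurableSet (S j))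
    (hfreq : ∀ j, S j ⊆ freqSet j (2 / 3)) (hS : ∀ j, coin (bias j) (S j) = 1) :
    Measure.hausdorffMeasure 1 curve = 2 ∧
      Measure.hausdorffMeasure 1 (curve \ (point '' S 0 ∪ point '' S 1)) = 0 := by
  have hne : ∀ j, S j ⊆ {ω | ¬ IsEventuallyConst ω} := fun j ω hω =>
    freqSet_not_eventuallyConst (by norm_num) (by norm_num) (hfreq j hω)
  have hmeas : ∀ j, MeasurableSet (point '' S j) := fun j =>
    (hm j).image_of_measurable_injOn isCoding_point.measurable (injOn_point.mono (hne j))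
  have hdisj : Disjoint (point '' S 0) (point '' S 1) :=
    disjoint_image_image fun ω hω τ hτ h =>
      disjoint_left.1 (disjoint_freqSet (by decide : (0 : Fin 2) ≠ 1)) (hfreq 0 hω)
        (injOn_point (hne 0 hω) (hne 1 hτ) h ▸ hfreq 1 hτ)
  have hsub : point '' S 0 ∪ point '' S 1 ⊆ curve :=
    union_subset (image_subset_range _ _) (image_subset_range _ _)
  have hge : 2 ≤ Measure.hausdorffMeasure 1 (point '' S 0 ∪ point '' S 1) := by
    rw [measure_union hdisj (hmeas 1)]
    exact one_add_one_eq_two.symm.le.trans <| add_le_add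
      ((hS 0).symm.le.trans (coin_bias_le_hausdorffMeasure 0 _))
      ((hS 1).symm.le.trans (coin_bias_le_hausdorffMeasure 1 _))
  have hle := hausdorffMeasure_curve_le
  have heq := hle.antisymm (hge.trans (measure_mono hsub))
  refine ⟨heq, ?_⟩
  rw [measure_sdiff hsub ((hmeas 0).union (hmeas 1)).nullMeasurableSet, heq]
  · exact tsub_eq_zero_of_le hge
  · exact ((measure_mono hsub).trans hle).trans_lt ENNReal.ofNat_lt_top |>.ne

/-! ### The curve as a graph -/

theorem exists_coord_eq (j : Fin 2) {t : ℝ} (ht : t ∈ Icc (0 : ℝ) 1) : ∃ ω, coord j ω = t := by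
  obtain ⟨k, hjk⟩ : ∃ k, j ≠ k := ⟨1 - j, by omega⟩
  have hcover : Icc (0 : ℝ) 1 ⊆ lineMap j 0 '' Icc 0 1 ∪ lineMap j 1 '' Icc 0 1 := by
    have hmem : ∀ i, ∀ s ∈ Icc (0 : ℝ) 1, lineMap j i s ∈
        lineMap j 0 '' Icc 0 1 ∪ lineMap j 1 '' Icc 0 1 := by
      intro i s hs
      have : i = 0 ∨ i = 1 := by omega
      rcases this with rfl | rfl
      · exact Or.inl ⟨s, hs, rfl⟩
      · exact Or.inr ⟨s, hs, rfl⟩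
    intro s hs
    obtain ⟨h0, h1⟩ := hs
    rcases le_total s (1 / 3) with h | h
    · have := hmem k (3 * s) ⟨by linarith, by linarith⟩
      rwa [lineMap_of_ne hjk.symm, show 1 / 3 * (3 * s) = s by ring] at this
    · have := hmem j (3 / 2 * (s - 1 / 3)) ⟨by linarith, by linarith⟩
      rwa [lineMap_self, show 2 / 3 * (3 / 2 * (s - 1 / 3)) + 1 / 3 = s by ring] at this
  exact (isCoding_coord j).subset_range (Metric.isBounded_Icc 0 1) hcover ht

theorem coord_mem_Icc (j : Fin 2) (ω : ℕ → Fin 2) : coord j ω ∈ Icc (0 : ℝ) 1 :=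
  ⟨coord_nonneg j ω, coord_le_one j ω⟩

open Classical in
/-- The function whose value at the `j`-th coordinate of a point of the curve is the `k`-th
coordinate of that point. -/
noncomputable def graphFun (j k : Fin 2) (t : ℝ) : ℝ :=
  if h : ∃ ω, coord j ω = t then coord k h.choose else 0

section

variable {j k : Fin 2}

theorem graphFun_coord (hjk : j ≠ k) (ω : ℕ → Fin 2) : graphFun j k (coord j ω) = coord k ω := by
  have h : ∃ τ, coord j τ = coord j ω := ⟨ω, rfl⟩
  rw [graphFun, dif_pos h]
  exact coord_eq_of_coord_eq hjk h.choose_spec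

theorem strictAntiOn_graphFun (hjk : j ≠ k) : StrictAntiOn (graphFun j k) (Icc 0 1) := by
  intro s hs t ht hst
  obtain ⟨ω, rfl⟩ := exists_coord_eq j hs
  obtain ⟨τ, rfl⟩ := exists_coord_eq j ht
  rw [graphFun_coord hjk, graphFun_coord hjk]
  exact coord_strictAnti hjk hst

theorem continuousOn_graphFun (hjk : j ≠ k) : ContinuousOn (graphFun j k) (Icc 0 1) := by
  rw [continuousOn_iff_continuous_domRestrict]
  let q : (ℕ → Fin 2) → Icc (0 : ℝ) 1 := fun ω => ⟨coord j ω, coord_mem_Icc j ω⟩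
  have hq : Continuous q := (continuous_coord j).subtype_mk _
  have hsurj : Function.Surjective q := fun t => by
    obtain ⟨ω, h⟩ := exists_coord_eq j t.2
    exact ⟨ω, Subtype.ext h⟩
  rw [(hq.isClosedMap.isQuotientMap hq hsurj).continuous_iff]
  have : (Icc (0 : ℝ) 1).domRestrict (graphFun j k) ∘ q = coord k := by
    funext ω; exact graphFun_coord hjk ω
  rw [this]
  exact continuous_coord k

theorem curve_eq_graph : curve = (fun t : ℝ => (!₂[t, graphFun 0 1 t] : Plane)) '' Icc 0 1 := by
  have h01 : (0 : Fin 2) ≠ 1 := by decide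
  ext x
  constructor
  · rintro ⟨ω, rfl⟩
    refine ⟨coord 0 ω, coord_mem_Icc 0 ω, ?_⟩
    simp only [graphFun_coord h01]; rfl
  · rintro ⟨t, ht, rfl⟩
    obtain ⟨ω, rfl⟩ := exists_coord_eq 0 ht
    refine ⟨ω, ?_⟩
    simp only [graphFun_coord h01]; rfl

/-! ### Tangents almost everywhere -/

theorem hasTangentLine_of_differentiable (hjk : j ≠ k) {ω : ℕ → Fin 2}
    (h : DifferentiableWithinAt ℝ (graphFun j k) (Icc 0 1) (coord j ω)) :
    HasTangentLine curve (point ω) := by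
  set m := derivWithin (graphFun j k) (Icc 0 1) (coord j ω) with hm
  let v : Plane := WithLp.toLp 2 fun i => if i = j then 1 else m
  have hvj : v j = 1 := by simp [v]
  have hvk : v k = m := by simp [v, hjk.symm]
  have hv : v ≠ 0 := fun h0 => by rw [h0] at hvj; simp at hvj
  refine ⟨AffineSubspace.mk' (point ω) (Submodule.span ℝ {v}), ?_, AffineSubspace.self_mem_mk' _ _,
    ⟨ω, rfl⟩, fun δ hδ => ?_⟩
  · rw [AffineSubspace.direction_mk', finrank_span_singleton hv]
  have hder := (hasDerivWithinAt_iff_isLittleO.1 h.hasDerivWithinAt).def (half_pos hδ)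
  obtain ⟨ε, hε, hball⟩ := Metric.mem_nhdsWithin_iff.1 hder
  refine ⟨ε, hε, ?_⟩
  rintro _ ⟨⟨τ, rfl⟩, hne⟩ hdist
  have hpos : 0 < dist (point ω) (point τ) := dist_pos.2 fun h => hne h.symm
  have hcoord := abs_apply_sub_le_dist (point ω) (point τ) j
  rw [point_apply, point_apply, abs_sub_comm] at hcoord
  have hd : ‖graphFun j k (coord j τ) - graphFun j k (coord j ω) -
      (coord j τ - coord j ω) • m‖ ≤ δ / 2 * ‖coord j τ - coord j ω‖ :=
    hball ⟨by rw [Metric.mem_ball, Real.dist_eq]; linarith, coord_mem_Icc j τ⟩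
  rw [graphFun_coord hjk, graphFun_coord hjk, smul_eq_mul, Real.norm_eq_abs,
    Real.norm_eq_abs] at hd
  set s := coord j τ - coord j ω with hs
  -- the point of the line above the same `j`-th coordinate
  have hmem : point ω + s • v ∈ AffineSubspace.mk' (point ω) (Submodule.span ℝ {v}) := by
    rw [AffineSubspace.mem_mk', vsub_eq_sub, add_sub_cancel_left]
    exact Submodule.smul_mem _ _ (Submodule.mem_span_singleton_self v)
  have hle : Metric.infDist (point τ) (AffineSubspace.mk' (point ω) (Submodule.span ℝ {v})) ≤
      δ / 2 * dist (point ω) (point τ) := by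
    refine (Metric.infDist_le_dist_of_mem hmem).trans ((dist_le_abs_add_abs hjk _ _).trans ?_)
    have e1 : point τ j - (point ω + s • v) j = 0 := by simp [hvj, hs]
    have e2 : point τ k - (point ω + s • v) k = coord k τ - coord k ω - s * m := by
      simp [hvk]; ring
    rw [e1, e2, abs_zero, zero_add]
    refine hd.trans ?_
    gcongr
  rw [div_lt_iff₀ hpos]
  refine hle.trans_lt ?_
  gcongr
  linarith

theorem ae_hasTangentLine_coin (j : Fin 2) :
    ∀ᵐ ω ∂(coin (bias j)), HasTangentLine curve (point ω) := by
  obtain ⟨k, hjk⟩ : ∃ k, j ≠ k := ⟨1 - j, by omega⟩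
  have h := ((strictAntiOn_graphFun hjk).antitoneOn.neg).ae_differentiableWithinAt
    measurableSet_Icc
  have h1 : ∀ᵐ t ∂((coin (bias j)).map (coord j)),
      DifferentiableWithinAt ℝ (graphFun j k) (Icc 0 1) t := by
    rw [map_coord_coin_bias]
    refine ae_mono (Measure.restrict_mono_set _ Ioc_subset_Icc_self) (h.mono fun t ht => ?_)
    exact differentiableWithinAt_fun_neg_iff.1 ht
  exact (ae_of_ae_map (continuous_coord j).aemeasurable h1).mono fun ω hω =>
    hasTangentLine_of_differentiable hjk hω

theorem hausdorffMeasure_curve_and_ae_hasTangentLine :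
    Measure.hausdorffMeasure 1 curve = 2 ∧
      ∀ᵐ x ∂((Measure.hausdorffMeasure 1).restrict curve), HasTangentLine curve x := by
  have hex (j : Fin 2) : ∃ S : Set (ℕ → Fin 2), MeasurableSet S ∧ S ⊆ freqSet j (2 / 3) ∧
      (∀ ω ∈ S, HasTangentLine curve (point ω)) ∧ coin (bias j) S = 1 := by
    have h := ae_mem_freqSet (bias j) j
    rw [bias_real_singleton] at h
    obtain ⟨S, hS, hSm, hS1⟩ := (h.and (ae_hasTangentLine_coin j)).exists_measurable_mem
    exact ⟨S, hSm, fun ω hω => (hS1 ω hω).1, fun ω hω => (hS1 ω hω).2,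
      (mem_ae_iff_prob_eq_one hSm).1 hS⟩
  choose S hSm hSf hSt hS1 using hex
  obtain ⟨h2, h0⟩ := hausdorffMeasure_split S hSm hSf hS1
  refine ⟨h2, ?_⟩
  rw [ae_restrict_iff' isCompact_curve.measurableSet]
  refine measure_mono_null (fun x hx => ?_) h0
  simp only [mem_compl_iff, mem_ofPred_eq, Classical.not_imp] at hx
  refine ⟨hx.1, ?_⟩
  rintro (⟨ω, hω, rfl⟩ | ⟨ω, hω, rfl⟩)
  · exact hx.2 (hSt 0 ω hω)
  · exact hx.2 (hSt 1 ω hω)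

/-! ### One-sided derivatives at junction points -/

/-- Seen in the direction of decreasing `j`-th coordinate, the curve leaves `y` along the `j`-th
axis. A bound from above suffices, since the `k`-th coordinate increases in this direction. -/
def IsFlatBelow (j k : Fin 2) (y : Plane) : Prop :=
  ∀ ε > 0, ∃ δ > 0, ∀ x ∈ curve, y j - δ < x j → x j < y j → x k - y k ≤ ε * (y j - x j)

/-- Near the fixed point of the `j`-th map the curve is compressed by `1/3` in the `k`-th and by
`2/3` in the `j`-th coordinate. -/
theorem coord_le_pow_mul (hjk : j ≠ k) (n : ℕ) {ω : ℕ → Fin 2} (h : 1 - coord j ω < (2 / 3) ^ n) :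
    coord k ω ≤ (1 / 2) ^ n * (1 - coord j ω) := by
  induction n generalizing ω with
  | zero => linarith [coord_add_le hjk ω]
  | succ n ih =>
    rw [pow_succ] at h ⊢
    have hω : ω 0 = j := by
      by_contra hω
      have : (2 / 3 : ℝ) ^ n ≤ 1 := pow_le_one₀ (by norm_num) (by norm_num)
      linarith [coord_le_third hω]
    have hω' : ω 0 ≠ k := by rwa [hω]
    have h1 := coord_of_eq hω
    have h2 := coord_of_ne hω'
    have h3 := ih (ω := shift ω) (by linarith)
    rw [h2, h1]
    linarith

theorem isFlatBelow_junction (hjk : j ≠ k) {z : Plane} (hj : z j = 1 / 3) (hk : z k = 1 / 3) :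
    IsFlatBelow j k z := by
  intro ε hε
  obtain ⟨n, hn⟩ := exists_pow_lt_of_lt_one (half_pos hε) (by norm_num : (1 / 2 : ℝ) < 1)
  refine ⟨1 / 3 * (2 / 3) ^ n, by positivity, ?_⟩
  rintro _ ⟨ω, rfl⟩ h1 h2
  rw [point_apply, hj] at h1 h2
  rw [point_apply, point_apply, hj, hk]
  have hω : ω 0 ≠ j := fun h => by linarith [third_le_coord h]
  have hω' := (eq_or_eq_of_ne hjk (ω 0)).resolve_left hω
  have h3 := coord_of_ne hω
  have h4 := coord_of_eq hω'
  have h5 := coord_le_pow_mul hjk n (ω := shift ω) (by linarith)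
  have h6 : (1 / 2 : ℝ) ^ n * (1 - coord j (shift ω)) ≤ ε / 2 * (1 - coord j (shift ω)) :=
    mul_le_mul_of_nonneg_right hn.le (by linarith [coord_le_one j (shift ω)])
  rw [h3, h4]
  linarith

theorem IsFlatBelow.planeMap (hjk : j ≠ k) {y : Plane} (hy : IsFlatBelow j k y) (hy0 : 0 < y j)
    (i : Fin 2) (hy1 : y j < 1) : IsFlatBelow j k (planeMap i y) := by
  intro ε hε
  have hrj := ratio_pos j i
  have hrk := ratio_pos k i
  obtain ⟨δ, hδ, h⟩ := hy (ε * (ratio j i / ratio k i)) (by positivity)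
  refine ⟨ratio j i * min δ (y j), mul_pos hrj (lt_min hδ hy0), ?_⟩
  rintro _ ⟨ω, rfl⟩ h1 h2
  rw [planeMap_apply, point_apply, lineMap] at h1 h2
  have hmin : ratio j i * min δ (y j) ≤ ratio j i * y j :=
    mul_le_mul_of_nonneg_left (min_le_right _ _) hrj.le
  have hmin' : ratio j i * min δ (y j) ≤ ratio j i * δ :=
    mul_le_mul_of_nonneg_left (min_le_left _ _) hrj.le
  -- the `j`-th coordinate determines to which piece a nearby point belongs
  have hω : ω 0 = i := by
    rcases eq_or_eq_of_ne hjk i with rfl | rfl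
    · by_contra hne
      have := coord_le_third hne
      simp only [offset, if_true] at h1
      linarith
    · by_contra hne
      have := third_le_coord ((eq_or_eq_of_ne hjk (ω 0)).resolve_right hne)
      simp only [offset, ratio, hjk.symm, if_false] at h2
      linarith
  have hcj := coord_shift j ω
  have hck := coord_shift k ω
  rw [hω, lineMap] at hcj hck
  have h3 := h (point (shift ω)) ⟨_, rfl⟩
    (by rw [point_apply]; nlinarith) (by rw [point_apply]; nlinarith)
  rw [point_apply, point_apply] at h3
  rw [planeMap_apply, planeMap_apply, point_apply, point_apply, ← hcj, ← hck, lineMap, lineMap]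
  calc ratio k i * coord k (shift ω) + offset k i - (ratio k i * y k + offset k i)
      = ratio k i * (coord k (shift ω) - y k) := by ring
    _ ≤ ratio k i * (ε * (ratio j i / ratio k i) * (y j - coord j (shift ω))) := by gcongr
    _ = _ := by field_simp; ring

end

theorem junction_apply (j : Fin 2) : junction (fun _ => 2 / 3) (fun _ => 1 / 3) j = 1 / 3 := by
  fin_cases j <;> norm_num [junction, curveMap, unitPt]

theorem junction_mem_curve : junction (fun _ => 2 / 3) (fun _ => 1 / 3) ∈ curve := by
  refine ⟨cons 0 fun _ => 1, plane_ext (by decide : (0 : Fin 2) ≠ 1) ?_ ?_⟩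
  · rw [point_apply, coord_cons, lineMap_self, coord_const_of_ne (by decide), junction_apply]
    norm_num
  · rw [point_apply, coord_cons, lineMap_of_ne (by decide), coord_const_self, junction_apply]
    norm_num

theorem wordMap_junction (w : List (Fin 2)) :
    (∀ j, wordMap planeMap w (junction (fun _ => 2 / 3) fun _ => 1 / 3) j ∈ Ioo (0 : ℝ) 1) ∧
    wordMap planeMap w (junction (fun _ => 2 / 3) fun _ => 1 / 3) ∈ curve ∧
    ∀ j k, j ≠ k →
      IsFlatBelow j k (wordMap planeMap w (junction (fun _ => 2 / 3) fun _ => 1 / 3)) := by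
  induction w with
  | nil =>
    refine ⟨fun j => ?_, junction_mem_curve, fun j k hjk =>
      isFlatBelow_junction hjk (junction_apply j) (junction_apply k)⟩
    rw [show wordMap planeMap [] = id from rfl, id, junction_apply]
    norm_num
  | cons i w ih =>
    obtain ⟨h1, h2, h3⟩ := ih
    refine ⟨fun j => ?_, planeMap_mem_curve i h2, fun j k hjk =>
      (h3 j k hjk).planeMap hjk (h1 j).1 i (h1 j).2⟩
    obtain ⟨h0, h1⟩ := h1 j
    rw [wordMap, Function.comp_apply, planeMap_apply]
    by_cases h : i = j
    · rw [h, lineMap_self]; constructor <;> linarith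
    · rw [lineMap_of_ne h]; constructor <;> linarith

theorem hasDerivWithinAt_graphFun {ω : ℕ → Fin 2} (h0 : 0 < coord 0 ω)
    (hflat : IsFlatBelow 0 1 (point ω)) :
    HasDerivWithinAt (graphFun 0 1) 0 (Iio (coord 0 ω)) (coord 0 ω) := by
  have h01 : (0 : Fin 2) ≠ 1 := by decide
  rw [hasDerivWithinAt_iff_isLittleO, Asymptotics.isLittleO_iff]
  intro ε hε
  obtain ⟨δ, hδ, h⟩ := hflat ε hε
  filter_upwards [self_mem_nhdsWithin,
    mem_nhdsWithin_of_mem_nhds (lt_mem_nhds (max_lt h0 (sub_lt_self (coord 0 ω) hδ)))] with t ht ht'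
  have ht1 := coord_le_one 0 ω
  obtain ⟨τ, rfl⟩ := exists_coord_eq 0
    ⟨((le_max_left _ _).trans_lt ht').le, (le_of_lt ht).trans ht1⟩
  have h1 := h (point τ) ⟨τ, rfl⟩ (by simpa using (le_max_right _ _).trans_lt ht')
    (by simpa using ht)
  simp only [point_apply] at h1
  have h2 := coord_strictAnti h01 ht
  have ht2 : coord 0 τ < coord 0 ω := ht
  rw [graphFun_coord h01, graphFun_coord h01, smul_zero, sub_zero, Real.norm_eq_abs,
    Real.norm_eq_abs, abs_of_pos (by linarith), abs_of_neg (by linarith)]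
  linarith

/-- To the right of the point the second coordinate decreases, so flatness along the second axis
means that the graph is vertical. -/
theorem tendsto_slope_graphFun {ω : ℕ → Fin 2} (h1 : coord 0 ω < 1)
    (hflat : IsFlatBelow 1 0 (point ω)) :
    Tendsto (fun t => (graphFun 0 1 t - graphFun 0 1 (coord 0 ω)) / (t - coord 0 ω))
      (𝓝[>] (coord 0 ω)) atBot := by
  have h01 : (0 : Fin 2) ≠ 1 := by decide
  refine tendsto_atBot.2 fun b => ?_
  obtain ⟨δ, hδ, h⟩ := hflat (1 / (|b| + 1)) (by positivity)
  have hcont : Tendsto (graphFun 0 1) (𝓝[>] (coord 0 ω)) (𝓝 (coord 1 ω)) := by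
    have := continuousOn_graphFun h01 (coord 0 ω) (coord_mem_Icc 0 ω)
    rw [ContinuousWithinAt, graphFun_coord h01] at this
    refine this.mono_left ?_
    rw [← nhdsWithin_Ioo_eq_nhdsGT h1]
    exact nhdsWithin_mono _ fun t ht => ⟨(coord_nonneg 0 ω).trans ht.1.le, ht.2.le⟩
  filter_upwards [self_mem_nhdsWithin, mem_nhdsWithin_of_mem_nhds (gt_mem_nhds h1),
    hcont (lt_mem_nhds (sub_lt_self (coord 1 ω) hδ))] with t ht ht1 htδ
  obtain ⟨τ, rfl⟩ := exists_coord_eq 0 ⟨(coord_nonneg 0 ω).trans (le_of_lt ht), le_of_lt ht1⟩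
  have ht2 : coord 0 ω < coord 0 τ := ht
  rw [mem_preimage, graphFun_coord h01, mem_ofPred_eq] at htδ
  have h3 := h (point τ) ⟨τ, rfl⟩ (by simpa using htδ) (by simpa using coord_strictAnti h01 ht2)
  simp only [point_apply] at h3
  rw [one_div_mul_eq_div, le_div_iff₀ (by positivity)] at h3
  rw [graphFun_coord h01, graphFun_coord h01, div_le_iff₀ (by linarith)]
  have h4 : -|b| * (coord 0 τ - coord 0 ω) ≤ b * (coord 0 τ - coord 0 ω) :=
    mul_le_mul_of_nonneg_right (neg_abs_le b) (by linarith)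
  linarith

/-! ### Recurrence of the fair walk -/

/-- The increment `+1` for the first and `-1` for the second letter. -/
def step (i : Fin 2) : ℤ := if i = 0 then 1 else -1

/-- The walk that counts the first letters minus the second letters among `ω₁ … ωₙ`. -/
def walk (n : ℕ) (ω : ℕ → Fin 2) : ℤ := ∑ k ∈ Finset.range n, step (ω k)

theorem step_eq (i : Fin 2) : step i = 1 ∨ step i = -1 := by
  unfold step; split_ifs <;> simp

theorem walk_succ (n : ℕ) (ω : ℕ → Fin 2) : walk (n + 1) ω = walk n ω + step (ω n) :=
  Finset.sum_range_succ _ _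

theorem neg_le_walk_le (n : ℕ) (ω : ℕ → Fin 2) : -(n : ℤ) ≤ walk n ω ∧ walk n ω ≤ n := by
  induction n with
  | zero => simp [walk]
  | succ n ih =>
    rw [walk_succ]
    rcases step_eq (ω n) with h | h <;> rw [h] <;> omega

/-- A walk with steps `±1` that is unbounded in both directions returns to `0` again and again. -/
theorem exists_walk_eq_zero {ω : ℕ → Fin 2}
    (ha : ¬ BddAbove (range fun n => (walk (n + 1) ω : ℝ)))
    (hb : ¬ BddBelow (range fun n => (walk (n + 1) ω : ℝ))) (N : ℕ) :
    ∃ n, N ≤ n ∧ walk n ω = 0 := by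
  by_contra! hne
  rcases lt_or_gt_of_ne (hne N le_rfl) with hN | hN
  · have hneg : ∀ n, N ≤ n → walk n ω < 0 := fun n hn => by
      induction n, hn using Nat.le_induction with
      | base => exact hN
      | succ n hn ih =>
        have h1 := hne (n + 1) (by omega)
        have h2 := walk_succ n ω
        rcases step_eq (ω n) with h | h <;> omega
    refine ha ⟨N, ?_⟩
    rintro _ ⟨n, rfl⟩
    have : walk (n + 1) ω ≤ (N : ℤ) := by
      rcases le_total N (n + 1) with h | h
      · have := hneg _ h; omega
      · have := (neg_le_walk_le (n + 1) ω).2; omega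
    change (walk (n + 1) ω : ℝ) ≤ N
    exact_mod_cast this
  · have hpos : ∀ n, N ≤ n → 0 < walk n ω := fun n hn => by
      induction n, hn using Nat.le_induction with
      | base => exact hN
      | succ n hn ih =>
        have h1 := hne (n + 1) (by omega)
        have h2 := walk_succ n ω
        rcases step_eq (ω n) with h | h <;> omega
    refine hb ⟨-N, ?_⟩
    rintro _ ⟨n, rfl⟩
    have : -(N : ℤ) ≤ walk (n + 1) ω := by
      rcases le_total N (n + 1) with h | h
      · have := hpos _ h; omega
      · have := (neg_le_walk_le (n + 1) ω).1; omega
    change -(N : ℝ) ≤ (walk (n + 1) ω : ℝ)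
    exact_mod_cast this

/-- The fair law on letters. -/
noncomputable def fair : Measure (Fin 2) := (PMF.uniformOfFintype (Fin 2)).toMeasure

instance : IsProbabilityMeasure fair := by unfold fair; infer_instance

theorem fairCoin_eq : fairCoin = coin fair := rfl

theorem fair_singleton (i : Fin 2) : fair {i} = 2⁻¹ := by
  rw [fair, PMF.toMeasure_apply_singleton _ _ (measurableSet_singleton i)]
  simp

theorem lintegral_fair (g : Fin 2 → ℝ≥0∞) : ∫⁻ i, g i ∂fair = 2⁻¹ * g 0 + 2⁻¹ * g 1 := by
  rw [lintegral_fintype]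
  simp [fair_singleton, Fin.sum_univ_two, mul_comm]

/-- The walk is a martingale with bounded increments that does not converge. By the martingale
convergence theorem it is almost surely unbounded in both directions. -/
theorem ae_exists_walk_eq_zero :
    ∀ᵐ ω ∂(coin fair), ∀ N, ∃ n, N ≤ n ∧ walk n ω = 0 := by
  let g : Fin 2 → ℝ := fun i => step i
  have hg : Measurable g := measurable_of_finite g
  let X : ℕ → (ℕ → Fin 2) → ℝ := fun n ω => g (ω n)
  have hX (n : ℕ) : StronglyMeasurable (X n) :=
    (continuous_letter g n).measurable.stronglyMeasurable
  have hind : ProbabilityTheory.iIndepFun X (coin fair) :=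
    ProbabilityTheory.iIndepFun_infinitePi (P := fun _ => fair) (X := fun _ => g)
      fun _ => hg
  have hbound (n : ℕ) (ω : ℕ → Fin 2) : ‖X n ω‖ ≤ 1 := by
    rcases step_eq (ω n) with h | h <;> simp [X, g, h]
  have hint (n : ℕ) : Integrable (X n) (coin fair) :=
    .of_bound (hX n).aestronglyMeasurable 1 (Eventually.of_forall (hbound n))
  have hmean (n : ℕ) : ∫ ω, X n ω ∂(coin fair) = 0 := by
    rw [show ∫ ω, X n ω ∂(coin fair) = ∫ i, g i ∂fair from integral_letter fair g n,
      integral_fintype (Integrable.of_finite)]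
    simp [measureReal_def, fair_singleton, Fin.sum_univ_two, g, step]
  let S : ℕ → (ℕ → Fin 2) → ℝ := fun n ω => (walk (n + 1) ω : ℝ)
  have hS_succ (n : ℕ) : S (n + 1) = S n + X (n + 1) := by
    funext ω; simp [S, X, g, walk_succ (n + 1)]
  have hS_zero : S 0 = X 0 := by funext ω; simp [S, X, g, walk]
  let ℱ := Filtration.natural X hX
  have hadapt : StronglyAdapted ℱ S := by
    have hXa : StronglyAdapted ℱ X := Filtration.stronglyAdapted_natural hX
    intro n
    induction n with
    | zero => rw [hS_zero]; exact hXa 0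
    | succ n ih => rw [hS_succ]; exact (ih.mono (ℱ.mono n.le_succ)).add (hXa (n + 1))
  have hSint (n : ℕ) : Integrable (S n) (coin fair) := by
    induction n with
    | zero => rw [hS_zero]; exact hint 0
    | succ n ih => rw [hS_succ]; exact ih.add (hint (n + 1))
  have hmart : Martingale S ℱ (coin fair) := by
    refine martingale_nat hadapt hSint fun n => ?_
    rw [hS_succ]
    have h1 := condExp_add (hSint n) (hint (n + 1)) (ℱ n)
    have h2 := hind.condExp_natural_ae_eq_of_lt hX n.lt_succ_self
    have h3 := condExp_of_stronglyMeasurable (ℱ.le n) (hadapt n) (hSint n)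
    filter_upwards [h1, h2] with ω h1 h2
    rw [h1, Pi.add_apply, h3, h2, hmean, add_zero]
  have hincr (n : ℕ) (ω : ℕ → Fin 2) : |S (n + 1) ω - S n ω| = 1 := by
    rw [hS_succ, Pi.add_apply, add_sub_cancel_left]
    rcases step_eq (ω (n + 1)) with h | h <;> simp [X, g, h]
  have hle : ∀ᵐ ω ∂(coin fair), ∀ n, |S (n + 1) ω - S n ω| ≤ ((1 : NNReal) : ℝ) :=
    Eventually.of_forall fun ω n => (hincr n ω).le
  filter_upwards [hmart.bddAbove_range_iff_bddBelow_range hle,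
    hmart.submartingale.bddAbove_iff_exists_tendsto hle] with ω h1 h2
  have hna : ¬ BddAbove (range fun n => S n ω) := fun hb => by
    obtain ⟨c, hc⟩ := h2.1 hb
    have h3 := ((hc.comp (tendsto_add_atTop_nat 1)).sub hc).abs
    simp only [Function.comp_def, hincr, sub_self, abs_zero] at h3
    exact one_ne_zero (tendsto_nhds_unique tendsto_const_nhds h3)
  exact exists_walk_eq_zero hna fun hb => hna (h1.2 hb)

theorem scale_eq_of_walk_eq_zero {n : ℕ} {ω : ℕ → Fin 2} (h : walk n ω = 0) :
    scale 0 n ω = scale 1 n ω := by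
  have key : ∀ n, scale 0 n ω = scale 1 n ω * (2 : ℝ) ^ walk n ω := by
    intro n
    induction n with
    | zero => simp [scale, walk]
    | succ n ih =>
      have hr : ratio 0 (ω n) = ratio 1 (ω n) * (2 : ℝ) ^ step (ω n) := by
        have : ω n = 0 ∨ ω n = 1 := by omega
        rcases this with h | h <;> rw [h] <;> norm_num [ratio, step]
      rw [scale, Finset.prod_range_succ, ← scale, ih, hr, walk_succ,
        zpow_add₀ (by norm_num : (2 : ℝ) ≠ 0), scale, scale, Finset.prod_range_succ]
      ring
  rw [key n, h, zpow_zero, mul_one]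

/-! ### Points without tangent -/

theorem exists_unit_normal (V : AffineSubspace ℝ Plane) (hV : Module.finrank ℝ V.direction = 1) :
    ∃ a b : ℝ, a ^ 2 + b ^ 2 = 1 ∧ ∀ u ∈ V.direction, a * u 0 + b * u 1 = 0 := by
  obtain ⟨⟨v, hv⟩, hv0, hspan⟩ := finrank_eq_one_iff'.1 hV
  have hpos : 0 < v 0 ^ 2 + v 1 ^ 2 := by
    by_contra hle
    have h0 : v 0 = 0 := by nlinarith [sq_nonneg (v 0), sq_nonneg (v 1)]
    have h1 : v 1 = 0 := by nlinarith [sq_nonneg (v 0), sq_nonneg (v 1)]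
    exact hv0 (Subtype.ext (plane_ext (by decide : (0 : Fin 2) ≠ 1) h0 h1))
  have hsq := Real.sq_sqrt hpos.le
  have hs := Real.sqrt_pos.2 hpos
  refine ⟨-v 1 / √(v 0 ^ 2 + v 1 ^ 2), v 0 / √(v 0 ^ 2 + v 1 ^ 2), ?_, fun u hu => ?_⟩
  · rw [div_pow, div_pow, hsq]; field_simp; ring
  · obtain ⟨c, hc⟩ := hspan ⟨u, hu⟩
    have hc' : c • v = u := congrArg Subtype.val hc
    rw [← hc']
    simp only [PiLp.smul_apply, smul_eq_mul]
    ring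

theorem abs_normal_le_infDist {V : AffineSubspace ℝ Plane} {a b : ℝ} (hab : a ^ 2 + b ^ 2 = 1)
    (hV : ∀ u ∈ V.direction, a * u 0 + b * u 1 = 0) {y : Plane} (hy : y ∈ V) (x : Plane) :
    |a * (x 0 - y 0) + b * (x 1 - y 1)| ≤ Metric.infDist x V := by
  refine (Metric.le_infDist ⟨y, hy⟩).2 fun v hv => ?_
  have h := hV (v -ᵥ y) (AffineSubspace.vsub_mem_direction hv hy)
  rw [vsub_eq_sub, PiLp.sub_apply, PiLp.sub_apply] at h
  rw [EuclideanSpace.dist_eq, Fin.sum_univ_two, Real.dist_eq, Real.dist_eq, sq_abs, sq_abs,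
    show a * (x 0 - y 0) + b * (x 1 - y 1) = a * (x 0 - v 0) + b * (x 1 - v 1) by linarith]
  refine Real.abs_le_sqrt ?_
  calc (a * (x 0 - v 0) + b * (x 1 - v 1)) ^ 2
      = (a ^ 2 + b ^ 2) * ((x 0 - v 0) ^ 2 + (x 1 - v 1) ^ 2) -
        (a * (x 1 - v 1) - b * (x 0 - v 0)) ^ 2 := by ring
    _ ≤ _ := by rw [hab, one_mul]; linarith [sq_nonneg (a * (x 1 - v 1) - b * (x 0 - v 0))]

/-- If `f_{ω₁…ωₙ}` is a homothety for arbitrarily large `n`, then arbitrarily small neighbourhoods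
of the point contain homothetic copies of the whole curve. A tangent would put the curve close to a
line relative to its size, but it contains three points that are not collinear. -/
theorem not_hasTangentLine {ω : ℕ → Fin 2}
    (hω : ∀ N, ∃ n, N ≤ n ∧ scale 0 n ω = scale 1 n ω) : ¬ HasTangentLine curve (point ω) := by
  rintro ⟨V, hdim, hyV, -, htan⟩
  obtain ⟨a, b, hab, hnormal⟩ := exists_unit_normal V hdim
  obtain ⟨ε, hε, hε'⟩ := htan (1 / 100) (by norm_num)
  obtain ⟨N, hN⟩ := exists_pow_lt_of_lt_one (half_pos hε) (by norm_num : (2 / 3 : ℝ) < 1)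
  obtain ⟨n, hn, hscale⟩ := hω N
  have hc := scale_pos 0 n ω
  have hcε : scale 0 n ω < ε / 2 := ((scale_le 0 n ω).trans
    (pow_le_pow_of_le_one (by norm_num) (by norm_num) hn)).trans_lt hN
  set c := scale 0 n ω
  set q := shift^[n] ω
  have key (τ : ℕ → Fin 2) :
      |a * (coord 0 τ - coord 0 q) + b * (coord 1 τ - coord 1 q)| ≤ 1 / 50 := by
    set x := prefixMap planeMap n ω (point τ) with hx
    have hxc : x ∈ curve := prefixMap_mem (fun i _ => planeMap_mem_curve i) n ω ⟨τ, rfl⟩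
    have h0 : x 0 - point ω 0 = c * (coord 0 τ - coord 0 q) := by
      rw [hx, coord_prefix, point_apply, point_apply]; ring
    have h1 : x 1 - point ω 1 = c * (coord 1 τ - coord 1 q) := by
      rw [hx, coord_prefix, point_apply, point_apply, ← hscale]; ring
    have habs (j : Fin 2) : |c * (coord j τ - coord j q)| ≤ c := by
      rw [abs_mul, abs_of_pos hc]
      refine mul_le_of_le_one_right hc.le (abs_le.2 ⟨?_, ?_⟩) <;>
        linarith [coord_nonneg j τ, coord_nonneg j q, coord_le_one j τ, coord_le_one j q]
    have hdist : dist (point ω) x ≤ 2 * c := by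
      rw [dist_comm]
      refine (dist_le_abs_add_abs (by decide : (0 : Fin 2) ≠ 1) _ _).trans ?_
      rw [h0, h1]; linarith [habs 0, habs 1]
    have hinf : Metric.infDist x V ≤ 1 / 50 * c := by
      by_cases hxy : x = point ω
      · rw [hxy, Metric.infDist_zero_of_mem hyV]; positivity
      · have h2 := hε' x ⟨hxc, hxy⟩ (by linarith)
        rw [div_lt_iff₀ (dist_pos.2 (Ne.symm hxy))] at h2
        linarith
    have h3 := (abs_normal_le_infDist hab hnormal hyV x).trans hinf
    rw [h0, h1, show a * (c * (coord 0 τ - coord 0 q)) + b * (c * (coord 1 τ - coord 1 q)) =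
      c * (a * (coord 0 τ - coord 0 q) + b * (coord 1 τ - coord 1 q)) by ring, abs_mul,
      abs_of_pos hc, mul_comm] at h3
    exact le_of_mul_le_mul_right h3 hc
  -- the points `(1,0)`, `(0,1)` and `(1/3,1/3)` of the curve
  have k1 := abs_le.1 (key fun _ => 0)
  have k2 := abs_le.1 (key fun _ => 1)
  have k3 := abs_le.1 (key (cons 0 fun _ => 1))
  rw [coord_cons, coord_cons, lineMap_self, lineMap_of_ne (by decide)] at k3
  rw [coord_const_self, coord_const_of_ne (by decide)] at k1 k2 k3
  have ha : |a| ≤ 1 / 2 := abs_le.2 ⟨by linarith, by linarith⟩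
  have hb : |b| ≤ 1 / 2 := abs_le.2 ⟨by linarith, by linarith⟩
  nlinarith [sq_abs a, sq_abs b, abs_nonneg a, abs_nonneg b]

/-- The image of the fair product measure. -/
noncomputable def fairMeasure : Measure Plane := fairCoin.map point

theorem ae_not_hasTangentLine :
    ∀ᵐ y ∂fairMeasure, y ∈ curve ∧ ¬ HasTangentLine curve y := by
  have hfreq := ae_mem_freqSet fair 0
  rw [measureReal_def, fair_singleton] at hfreq
  obtain ⟨S, hS, hSm, hS1⟩ := (hfreq.and ae_exists_walk_eq_zero).exists_measurable_mem
  -- the image of `S` is Borel since `point` is injective on it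
  have hmeas : MeasurableSet (point '' S) :=
    hSm.image_of_measurable_injOn isCoding_point.measurable (injOn_point.mono fun ω hω =>
      freqSet_not_eventuallyConst (by norm_num) (by norm_num) (hS1 ω hω).1)
  have hae : ∀ᵐ y ∂fairMeasure, y ∈ point '' S := by
    refine (ae_map_iff isCoding_point.measurable.aemeasurable hmeas).2 ?_
    rw [fairCoin_eq]
    filter_upwards [hS] with ω hω using ⟨ω, hω, rfl⟩
  refine hae.mono ?_
  rintro _ ⟨ω, hω, rfl⟩
  refine ⟨⟨ω, rfl⟩, not_hasTangentLine fun N => ?_⟩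
  obtain ⟨n, hn, h0⟩ := (hS1 ω hω).2 N
  exact ⟨n, hn, scale_eq_of_walk_eq_zero h0⟩

/-! ### The invariant measure and the address map -/

theorem measurable_planeMap (i : Fin 2) : Measurable (planeMap i) :=
  (isCoding_point.lipschitz i).continuous.measurable

theorem isHalfSelfSimilar_fairMeasure : IsHalfSelfSimilar planeMap fairMeasure where
  isProb := by
    rw [fairMeasure, fairCoin_eq]
    exact Measure.isProbabilityMeasure_map isCoding_point.measurable.aemeasurable
  eq_sum B hB := by
    have h := isCoding_point.lintegral_map_coin fair (g := indicator B 1)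
      (measurable_one.indicator hB)
    have hpre (i : Fin 2) : (fun x => indicator B (1 : Plane → ℝ≥0∞) (planeMap i x)) =
        indicator (planeMap i ⁻¹' B) 1 := rfl
    rw [lintegral_fair, hpre, hpre, lintegral_indicator_one hB,
      lintegral_indicator_one (measurable_planeMap 0 hB),
      lintegral_indicator_one (measurable_planeMap 1 hB)] at h
    exact h

theorem eq_fairMeasure {μ : Measure Plane} (hμ : IsHalfSelfSimilar planeMap μ) :
    μ = fairMeasure := by
  have := hμ.isProb
  refine isCoding_point.eq_map_coin fair μ fun g hg => ?_
  have h : μ = (2⁻¹ : ℝ≥0∞) • μ.map (planeMap 0) + (2⁻¹ : ℝ≥0∞) • μ.map (planeMap 1) := by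
    ext B hB
    rw [hμ.eq_sum B hB, Measure.add_apply, Measure.smul_apply, Measure.smul_apply,
      Measure.map_apply (measurable_planeMap 0) hB, Measure.map_apply (measurable_planeMap 1) hB,
      smul_eq_mul, smul_eq_mul]
  rw [lintegral_fair]
  conv_lhs => rw [h]
  rw [lintegral_add_measure, lintegral_smul_measure, lintegral_smul_measure,
    lintegral_map hg (measurable_planeMap 0), lintegral_map hg (measurable_planeMap 1),
    smul_eq_mul, smul_eq_mul]

theorem wordMap_ofFn (f : Fin 2 → Plane → Plane) (n : ℕ) (ω : ℕ → Fin 2) :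
    wordMap f (List.ofFn fun k : Fin n => ω k) = prefixMap f n ω := by
  induction n generalizing ω with
  | zero => rfl
  | succ n ih =>
    rw [List.ofFn_succ]
    exact congrArg (f (ω 0) ∘ ·) (ih (shift ω))

theorem isAddressMap_point : IsAddressMap planeMap curve point := fun ω => by
  simp only [wordMap_ofFn]
  exact isCoding_point.iInter_prefixMap_image ω

end SelfAffineCurve

open SelfAffineCurve in
theorem mainTheorem5 (lam nu : Fin 2 → ℝ)
    (hlam : ∀ i, lam i = 2 / 3) (hnu : ∀ i, nu i = 1 / 3) :
    (∃! J : Set Plane, IsSelfAffineSet (curveMap lam nu) J) ∧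
    ∀ J : Set Plane, IsSelfAffineSet (curveMap lam nu) J →
      Measure.hausdorffMeasure 1 J = 2 ∧
      (∀ᵐ x ∂((Measure.hausdorffMeasure 1).restrict J), HasTangentLine J x) ∧
      (∃ ψ : ℝ → ℝ, ContinuousOn ψ (Icc 0 1) ∧ StrictAntiOn ψ (Icc 0 1) ∧
        J = (fun t : ℝ => (!₂[t, ψ t] : Plane)) '' Icc 0 1 ∧
        ∀ (w : List (Fin 2)) (y : Plane),
          y = wordMap (curveMap lam nu) w (junction lam nu) →
            y 0 ∈ Ioo (0 : ℝ) 1 ∧ ψ (y 0) = y 1 ∧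
            HasDerivWithinAt ψ 0 (Iio (y 0)) (y 0) ∧
            Tendsto (fun t : ℝ => (ψ t - ψ (y 0)) / (t - y 0)) (𝓝[>] (y 0)) atBot) ∧
      ∃ (π : (ℕ → Fin 2) → Plane) (μ : Measure Plane),
        Continuous π ∧ IsAddressMap (curveMap lam nu) J π ∧
        μ = Measure.map π fairCoin ∧
        IsHalfSelfSimilar (curveMap lam nu) μ ∧
        (∀ μ' : Measure Plane, IsHalfSelfSimilar (curveMap lam nu) μ' → μ' = μ) ∧
        ∀ᵐ y ∂μ, y ∈ J ∧ ¬ HasTangentLine J y := by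
  obtain rfl : lam = fun _ => 2 / 3 := funext hlam
  obtain rfl : nu = fun _ => 1 / 3 := funext hnu
  have huniq (J : Set Plane) (hJ : IsSelfAffineSet planeMap J) : J = curve :=
    isCoding_point.eq_range hJ.nonempty hJ.isCompact hJ.eq_union
  have h01 : (0 : Fin 2) ≠ 1 := by decide
  refine ⟨⟨curve, isSelfAffineSet_curve, huniq⟩, fun J hJ => ?_⟩
  obtain rfl := huniq J hJ
  obtain ⟨hlength, htangent⟩ := hausdorffMeasure_curve_and_ae_hasTangentLine
  refine ⟨hlength, htangent, ⟨graphFun 0 1, continuousOn_graphFun h01, strictAntiOn_graphFun h01,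
    curve_eq_graph, ?_⟩, point, fairMeasure, isCoding_point.continuous, isAddressMap_point, rfl,
    isHalfSelfSimilar_fairMeasure, fun μ' hμ' => eq_fairMeasure hμ',
    ae_not_hasTangentLine⟩
  intro w y hy
  obtain ⟨hIoo, hmem, hflat⟩ := wordMap_junction w
  change y = wordMap planeMap w _ at hy
  rw [← hy] at hIoo hmem hflat
  obtain ⟨ω, rfl⟩ := hmem
  have h0 := hIoo 0
  rw [point_apply] at h0
  simp only [point_apply]
  exact ⟨h0, graphFun_coord h01 ω, hasDerivWithinAt_graphFun h0.1 (hflat 0 1 h01),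
    tendsto_slope_graphFun h0.2 (hflat 1 0 h01.symm)⟩
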